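/- Let $N\ge 2$, $R>0$, and $\Omega=B(0,R)\subset\mathbb R^N$ the open ball. For $u\in L^1(\Omega)$ let $$TV(u)=\int_\Omega|Du|=\sup\Big\{\int_\Omega u\,\mathrm{div}\,\varphi\,dx \;:\; \varphi\in C_c^\infty(\Omega,\mathbb R^N),\ |\varphi(x)|\le 1\ \text{for all } x\in\Omega\Big\}\in[0,\infty],$$ and let $BV(\Omega)$ be the set of $u\in L^1(\Omega)$ with $TV(u)<\infty$. For $\lambda>0$ and $g\in L^2(\Omega)$ let $$T_\lambda(g)=\operatorname*{arg\,min}_{u\in BV(\Omega)}\ \lambda\int_\Omega|Du|+\tfrac12\|u-g\|_{L^2(\Omega)}^2,$$ and let $T_0$ be the identity of $L^2(\Omega)$. Then: 1. For every $\lambda>0$ and every $g\in L^2(\Omega)$ the minimizer $T_\lambda(g)\in L^2(\Omega)\cap BV(\Omega)$ exists and is unique (as a class of functions up to equality almost everywhere), and $T_\lambda=(I+\lambda\,\partial TV)^{-1}$, where $\partial TV$ is the subdifferential in $L^2(\Omega)$ of $TV:L^2(\Omega)\to[0,\infty]$; that is, $u=T_\lambda(g)$ if and only if $g\in u+\lambda\,\partial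 TV(u)$. 2. If $g\in L^2(\Omega)$ is radial (that is, $g(x)$ agrees for almost every $x\in\Omega$ with a function of $|x|$), then for all real $\mu>\lambda\ge 0$ $$T_\mu(g)=T_{\mu-\lambda}\big(T_\lambda(g)\big).$$ -/

import Mathlib

open MeasureTheory
open scoped ENNReal ContDiff

noncomputable section

namespace ROF

/-- The space `ℝ^N` with its Euclidean norm. -/
abbrev Euc (N : ℕ) : Type := EuclideanSpace ℝ (Fin N)

variable {N : ℕ}

/-- The divergence `∑ i, ∂ φ_i / ∂ x_i` of a vector field. -/
def divergence (φ : Euc N → Euc N) (x : Euc N) : ℝ :=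
  ∑ i : Fin N, (fderiv ℝ φ x (EuclideanSpace.single i 1)) i

/-- Smooth vector fields with compact support in `Ω` and pointwise Euclidean norm at most one. -/
structure IsTestField (Ω : Set (Euc N)) (φ : Euc N → Euc N) : Prop where
  smooth : ContDiff ℝ ∞ φ
  compactSupport : HasCompactSupport φ
  support_subset : tsupport φ ⊆ Ω
  norm_le_one : ∀ x ∈ Ω, ‖φ x‖ ≤ 1

/-- The total variation `|Du|(Ω)`, with values in `[0, ∞]`. Since `φ = 0` is a test field, taking
positive parts does not change the supremum. -/
def TV (Ω : Set (Euc N)) (u : Euc N → ℝ) : ℝ≥0∞ :=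
  ⨆ (φ : Euc N → Euc N) (_ : IsTestField Ω φ),
    ENNReal.ofReal (∫ x in Ω, u x * divergence φ x)

/-- `u ∈ BV(Ω)`: `u` is integrable on `Ω` and has finite total variation there. -/
structure MemBV (Ω : Set (Euc N)) (u : Euc N → ℝ) : Prop where
  integrable : IntegrableOn u Ω
  tv_lt_top : TV Ω u < ⊤

/-- The Hilbert space `L²(Ω)`. -/
abbrev L2 (Ω : Set (Euc N)) : Type := Lp ℝ 2 (volume.restrict Ω)

/-- The energy `lam ∫_Ω |Du| + (1/2) ‖u - g‖₂²`, with values in `[0, ∞]`; it is infinite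
when `u - g` is not square integrable. -/
def energy (Ω : Set (Euc N)) (lam : ℝ) (g u : Euc N → ℝ) : ℝ≥0∞ :=
  ENNReal.ofReal lam * TV Ω u + 2⁻¹ * ∫⁻ x in Ω, ‖u x - g x‖ₑ ^ 2

/-- `u` minimizes the energy with parameter `lam` and datum `g` over `BV(Ω)`. -/
structure IsMinimizer (Ω : Set (Euc N)) (lam : ℝ) (g u : L2 Ω) : Prop where
  memBV : MemBV Ω u
  le : ∀ v : Euc N → ℝ, MemBV Ω v → energy Ω lam g u ≤ energy Ω lam g v

open Classical in
/-- The operator `T_lam` on `L²(Ω)`: `T_0` is the identity, and for `lam > 0`, `T_lam g` is the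
minimizer over `BV(Ω)` of the energy with datum `g`. -/
def T (Ω : Set (Euc N)) (lam : ℝ) (g : L2 Ω) : L2 Ω :=
  if lam = 0 then g
  else if h : ∃ u : L2 Ω, IsMinimizer Ω lam g u then h.choose
  else 0

/-- The subdifferential at `u` of the total variation, as a functional `L²(Ω) → [0, ∞]`. -/
def subdiffTV (Ω : Set (Euc N)) (u : L2 Ω) : Set (L2 Ω) :=
  {p | TV Ω u < ⊤ ∧
    ∀ v : L2 Ω, (TV Ω u : EReal) + ((inner ℝ p (v - u) : ℝ) : EReal) ≤ (TV Ω v : EReal)}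

/-- `g` is radial: it agrees almost everywhere on `Ω` with a function of `‖x‖`. -/
def IsRadial (Ω : Set (Euc N)) (g : L2 Ω) : Prop :=
  ∃ γ : ℝ → ℝ, ∀ᵐ x ∂(volume.restrict Ω), g x = γ ‖x‖

end ROF

end

/-!
The total variation is the support function of a closed convex set `K ⊆ L²(Ω)`, the closure of the
divergences of test fields. Hence `∂TV(u)` consists of the points of `K` at which `⟪u, ·⟫` is
maximal, and the resolvent `(I + ν ∂TV)⁻¹` is obtained by projecting on `K`.

Let `g` be a radial function which is constant on `n` concentric shells of equal width. The
resolvents preserve this form. A function `p` of this form lies in `K` if and only if its fluxes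
satisfy `|∫_{B_r} p| ≤ Per(B_r)` for all `r < R` and `∫_{B_R} p = 0`; as `Per(B_r)` is a concave
function of the volume of `B_r`, it suffices to test the spheres which separate the shells. Moreover
`p ∈ ∂TV(u)` if and only if the flux of `p` takes the extremal value `± Per(B_r)`, with the sign of
the jump, on each sphere across which `u` jumps. By concavity again, a flux which is extremal on a
sphere has a jump of the same sign there. So if `q ∈ ∂TV(w)`, then the jumps of `w` persist in
`u = w + ν q`, which yields `∂TV(u) ⊆ ∂TV(w)`. If now `g = u + λ p` with `p ∈ ∂TV(u)`, then
`g = w + (λ p + ν q)`, where `λ p + ν q ∈ (λ + ν) ∂TV(w)` by convexity.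

The radial functions of this form are dense among all radial functions, and the resolvents are
nonexpansive.
-/

namespace ROF

section Hilbert

variable {H : Type*} [NormedAddCommGroup H] [InnerProductSpace ℝ H] {K : Set H} {u p u' p' : H}

/-- `p` is a point of `K` at which the linear form `⟪u, ·⟫` attains its maximum over `K`. When `K`
is closed and convex, this says that `p` is a subgradient at `u` of the support function of `K`. -/
structure IsSupport (K : Set H) (u p : H) : Prop where
  mem : p ∈ K
  inner_le : ∀ k ∈ K, inner ℝ u k ≤ inner ℝ u p

theorem exists_isSupport_add_smul [CompleteSpace H] (hne : K.Nonempty) (hcl : IsClosed K)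
    (hcv : Convex ℝ K) {ν : ℝ} (hν : 0 < ν) (g : H) :
    ∃ u p, IsSupport K u p ∧ g = u + ν • p := by
  -- `p` is the projection of `ν⁻¹ • g` on `K`
  obtain ⟨p, hp, hmin⟩ := exists_norm_eq_iInf_of_complete_convex hne hcl.isComplete hcv (ν⁻¹ • g)
  rw [norm_eq_iInf_iff_real_inner_le_zero hcv hp] at hmin
  have hu : g - ν • p = ν • (ν⁻¹ • g - p) := by
    rw [smul_sub, smul_inv_smul₀ hν.ne']
  refine ⟨g - ν • p, p, ⟨hp, fun k hk => ?_⟩, by abel⟩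
  have hk' := hmin k hk
  rw [inner_sub_right] at hk'
  rw [hu, real_inner_smul_left, real_inner_smul_left]
  exact mul_le_mul_of_nonneg_left (by linarith) hν.le

theorem IsSupport.inner_sub_nonneg (h : IsSupport K u p) (h' : IsSupport K u' p') :
    0 ≤ inner ℝ (u - u') (p - p') := by
  have h₁ := h.inner_le p' h'.mem
  have h₂ := h'.inner_le p h.mem
  simp only [inner_sub_left, inner_sub_right]
  linarith

theorem norm_le_norm_add_smul_of_inner_nonneg {ν : ℝ} (hν : 0 ≤ ν) {a b : H}
    (h : 0 ≤ inner ℝ a b) : ‖a‖ ≤ ‖a + ν • b‖ := by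
  refine le_of_sq_le_sq ?_ (norm_nonneg _)
  rw [norm_add_sq_real, real_inner_smul_right]
  linarith [mul_nonneg hν h, sq_nonneg ‖ν • b‖]

theorem IsSupport.norm_sub_le (h : IsSupport K u p) (h' : IsSupport K u' p') {ν : ℝ}
    (hν : 0 ≤ ν) : ‖u - u'‖ ≤ ‖(u + ν • p) - (u' + ν • p')‖ := by
  have hle := norm_le_norm_add_smul_of_inner_nonneg hν (h.inner_sub_nonneg h')
  rwa [show u - u' + ν • (p - p') = (u + ν • p) - (u' + ν • p') by rw [smul_sub]; abel] at hle

theorem IsSupport.convexCombination (hcv : Convex ℝ K) (h : IsSupport K u p)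
    (h' : IsSupport K u p') {s t : ℝ} (hs : 0 ≤ s) (ht : 0 ≤ t) (hst : s + t = 1) :
    IsSupport K u (s • p + t • p') where
  mem := hcv h.mem h'.mem hs ht hst
  inner_le k hk := calc
    inner ℝ u k = s * inner ℝ u k + t * inner ℝ u k := by rw [← add_mul, hst, one_mul]
    _ ≤ s * inner ℝ u p + t * inner ℝ u p' := by
      gcongr
      exacts [h.inner_le k hk, h'.inner_le k hk]
    _ = inner ℝ u (s • p + t • p') := by
      rw [inner_add_right, real_inner_smul_right, real_inner_smul_right]

/-- The combination of the increments of `x` with coefficients `a`. If `x` is a chain of indicator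
functions of nested sets, this is the step function with value `a k` on the `k`-th shell. -/
def stepSum (n : ℕ) (x : ℕ → H) (a : ℕ → ℝ) : H :=
  ∑ k ∈ Finset.range n, a k • (x (k + 1) - x k)

theorem stepSum_add_smul (n : ℕ) (x : ℕ → H) (a b : ℕ → ℝ) (s : ℝ) :
    stepSum n x a + s • stepSum n x b = stepSum n x (fun k => a k + s * b k) := by
  simp only [stepSum, Finset.smul_sum, ← Finset.sum_add_distrib, add_smul, smul_smul]

theorem stepSum_neg (n : ℕ) (x : ℕ → H) (a : ℕ → ℝ) : stepSum n x (-a) = -stepSum n x a := by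
  simp only [stepSum, Pi.neg_apply, neg_smul, Finset.sum_neg_distrib]

theorem inner_stepSum (n : ℕ) (x : ℕ → H) (a : ℕ → ℝ) (p : H) :
    inner ℝ (stepSum n x a) p =
      ∑ k ∈ Finset.range n, a k * (inner ℝ (x (k + 1)) p - inner ℝ (x k) p) := by
  simp only [stepSum, sum_inner, real_inner_smul_left, inner_sub_left]

/-- A chain `x 0 = 0, …, x n` of vectors with the inner products `t (min j k)` of nested indicator
functions, such that the elements of the span of the chain which belong to `K` are described by the
bounds `|⟪x k, p⟫| ≤ c k` and `⟪x n, p⟫ = 0`, where `c` is a concave function of `t`. In the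
application `K` is the dual ball of the total variation, `x k` the indicator of a ball, `t k` its
volume and `c k` its perimeter. -/
structure IsConcaveChain (K : Set H) (n : ℕ) (x : ℕ → H) (t c : ℕ → ℝ) : Prop where
  lt : ∀ k < n, t k < t (k + 1)
  zero : x 0 = 0
  inner_eq : ∀ j k, j ≤ k → k ≤ n → inner ℝ (x j) (x k) = t j
  concave : ∀ k, k + 1 < n →
    (c (k + 2) - c (k + 1)) / (t (k + 2) - t (k + 1)) ≤ (c (k + 1) - c k) / (t (k + 1) - t k)
  abs_le : ∀ p ∈ K, ∀ k ≤ n, |inner ℝ (x k) p| ≤ c k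
  last : ∀ p ∈ K, inner ℝ (x n) p = 0
  mem : ∀ a : ℕ → ℝ, (∀ k ≤ n, |inner ℝ (x k) (stepSum n x a)| ≤ c k) →
    inner ℝ (x n) (stepSum n x a) = 0 → stepSum n x a ∈ K

namespace IsConcaveChain

variable {n : ℕ} {x : ℕ → H} {t c : ℕ → ℝ}

theorem inner_increment_of_lt (h : IsConcaveChain K n x t c) {j k : ℕ} (hjk : j < k)
    (hk : k < n) : inner ℝ (x (j + 1) - x j) (x (k + 1) - x k) = 0 := by
  rw [inner_sub_left, inner_sub_right, inner_sub_right, h.inner_eq _ _ (by lia) (by lia),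
    h.inner_eq _ _ (by lia) (by lia), h.inner_eq _ _ (by lia) (by lia),
    h.inner_eq _ _ (by lia) (by lia)]
  ring

theorem inner_increment_of_ne (h : IsConcaveChain K n x t c) {j k : ℕ} (hj : j < n) (hk : k < n)
    (hjk : j ≠ k) : inner ℝ (x (j + 1) - x j) (x (k + 1) - x k) = 0 := by
  rcases hjk.lt_or_gt with hlt | hlt
  · exact h.inner_increment_of_lt hlt hk
  · rw [real_inner_comm, h.inner_increment_of_lt hlt hj]

theorem inner_increment_self (h : IsConcaveChain K n x t c) {k : ℕ} (hk : k < n) :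
    inner ℝ (x (k + 1) - x k) (x (k + 1) - x k) = t (k + 1) - t k := by
  rw [inner_sub_left, inner_sub_right, inner_sub_right, real_inner_comm (x k) (x (k + 1)),
    h.inner_eq _ _ le_rfl (by lia), h.inner_eq _ _ (by lia) (by lia),
    h.inner_eq _ _ le_rfl (by lia)]
  ring

theorem inner_succ_sub_inner_stepSum (h : IsConcaveChain K n x t c) {k : ℕ} (hk : k < n)
    (a : ℕ → ℝ) :
    inner ℝ (x (k + 1)) (stepSum n x a) - inner ℝ (x k) (stepSum n x a) =
      a k * (t (k + 1) - t k) := by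
  rw [← inner_sub_left, stepSum, inner_sum, Finset.sum_eq_single_of_mem k (Finset.mem_range.2 hk),
    real_inner_smul_right, h.inner_increment_self hk]
  intro j hj hjk
  rw [real_inner_smul_right, h.inner_increment_of_ne hk (Finset.mem_range.1 hj) hjk.symm, mul_zero]

theorem exists_stepSum_inner_eq (h : IsConcaveChain K n x t c) (F : ℕ → ℝ) (hF : F 0 = 0) :
    ∃ a, ∀ k ≤ n, inner ℝ (x k) (stepSum n x a) = F k := by
  refine ⟨fun k => (F (k + 1) - F k) / (t (k + 1) - t k), fun k => ?_⟩
  induction k with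
  | zero => intro _; rw [h.zero, inner_zero_left, hF]
  | succ k ih =>
    intro hk
    have hinc := h.inner_succ_sub_inner_stepSum (k := k) (by lia)
      (fun k => (F (k + 1) - F k) / (t (k + 1) - t k))
    rw [div_mul_cancel₀ _ (sub_pos.2 (h.lt k (by lia))).ne', ih (by lia)] at hinc
    linarith

/-- The orthogonal projection onto the span of the chain maps `K` into itself. -/
theorem exists_stepSum_mem (h : IsConcaveChain K n x t c) {p : H} (hp : p ∈ K) :
    ∃ a, stepSum n x a ∈ K ∧
      ∀ b, inner ℝ (stepSum n x b) (stepSum n x a) = inner ℝ (stepSum n x b) p := by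
  obtain ⟨a, ha⟩ := h.exists_stepSum_inner_eq (fun k => inner ℝ (x k) p)
    (by rw [h.zero, inner_zero_left])
  refine ⟨a, h.mem a (fun k hk => ?_) ?_, fun b => ?_⟩
  · rw [ha k hk]
    exact h.abs_le p hp k hk
  · rw [ha n le_rfl]
    exact h.last p hp
  · rw [inner_stepSum, inner_stepSum]
    refine Finset.sum_congr rfl fun k hk => ?_
    have hkn := Finset.mem_range.1 hk
    rw [ha _ (by lia), ha _ (by lia)]

theorem exists_eq_stepSum_of_eq_add_smul (h : IsConcaveChain K n x t c) {ν : ℝ} (hν : 0 < ν)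
    (hup : IsSupport K u p) {b : ℕ → ℝ} (hg : stepSum n x b = u + ν • p) :
    ∃ d a, u = stepSum n x d ∧ p = stepSum n x a := by
  -- the projection `q` of `p` satisfies `ν * ⟪p, q⟫ ≥ ν * ⟪p, p⟫`, which forces `q = p`
  obtain ⟨a, haK, ha⟩ := h.exists_stepSum_mem hup.mem
  suffices p = stepSum n x a from ⟨fun k => b k + -ν * a k, a, by
    rw [← stepSum_add_smul, hg, ← this, neg_smul, add_neg_cancel_right], this⟩
  set q := stepSum n x a
  have hqp : inner ℝ q q = inner ℝ p q := by rw [ha a, real_inner_comm]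
  have hpp : inner ℝ p p ≤ inner ℝ p q := by
    have hle := hup.inner_le q haK
    rw [eq_sub_of_add_eq hg.symm, inner_sub_left, inner_sub_left, real_inner_smul_left,
      real_inner_smul_left, ha b] at hle
    exact le_of_mul_le_mul_left (by linarith) hν
  refine sub_eq_zero.1 (real_inner_self_nonpos.1 ?_)
  rw [real_inner_sub_sub_self, hqp]
  linarith

theorem inner_stepSum_eq (h : IsConcaveChain K n x t c) (a : ℕ → ℝ) (hp : p ∈ K) :
    inner ℝ (stepSum n x a) p =
      ∑ k ∈ Finset.range (n - 1), (a k - a (k + 1)) * inner ℝ (x (k + 1)) p := by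
  have abel_summation (m : ℕ) :
      ∑ k ∈ Finset.range (m + 1), a k * (inner ℝ (x (k + 1)) p - inner ℝ (x k) p) =
        ∑ k ∈ Finset.range m, (a k - a (k + 1)) * inner ℝ (x (k + 1)) p
          + a m * inner ℝ (x (m + 1)) p := by
    induction m with
    | zero => simp [h.zero]
    | succ m ih => rw [Finset.sum_range_succ, ih, Finset.sum_range_succ]; ring
  rw [inner_stepSum]
  cases n with
  | zero => simp
  | succ m => rw [abel_summation, h.last p hp, mul_zero, add_zero, Nat.add_sub_cancel]

theorem mul_inner_le (h : IsConcaveChain K n x t c) (hp : p ∈ K) {k : ℕ} (hk : k ≤ n) (s : ℝ) :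
    s * inner ℝ (x k) p ≤ |s| * c k :=
  (le_abs_self _).trans <| (abs_mul _ _).trans_le <|
    mul_le_mul_of_nonneg_left (h.abs_le p hp k hk) (abs_nonneg s)

theorem exists_mem_inner_eq_mul (h : IsConcaveChain K n x t c) (hK : K.Nonempty) {σ : ℕ → ℝ}
    (hσ : ∀ k, |σ k| ≤ 1) : ∃ q ∈ K, ∀ k, k + 1 < n → inner ℝ (x (k + 1)) q = σ k * c (k + 1) := by
  obtain ⟨p, hp⟩ := hK
  have c_nonneg {k : ℕ} (hk : k ≤ n) : 0 ≤ c k := (abs_nonneg _).trans (h.abs_le p hp k hk)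
  obtain ⟨b, hb⟩ := h.exists_stepSum_inner_eq
    (fun k => if k = 0 ∨ k = n then 0 else σ (k - 1) * c k) (by simp)
  refine ⟨stepSum n x b, h.mem b (fun k hk => ?_) (by rw [hb n le_rfl]; simp), fun k hk => ?_⟩
  · rw [hb k hk]
    split_ifs
    · simpa using c_nonneg hk
    · rw [abs_mul, abs_of_nonneg (c_nonneg hk)]
      exact mul_le_of_le_one_left (c_nonneg hk) (hσ _)
  · rw [hb _ hk.le, if_neg (by lia), Nat.add_sub_cancel]

theorem isSupport_stepSum_iff_mul_eq (h : IsConcaveChain K n x t c) (a : ℕ → ℝ) (hp : p ∈ K) :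
    IsSupport K (stepSum n x a) p ↔
      ∀ k, k + 1 < n →
        (a k - a (k + 1)) * inner ℝ (x (k + 1)) p = |a k - a (k + 1)| * c (k + 1) := by
  have bound {q : H} (hq : q ∈ K) : ∀ k ∈ Finset.range (n - 1),
      (a k - a (k + 1)) * inner ℝ (x (k + 1)) q ≤ |a k - a (k + 1)| * c (k + 1) :=
    fun k hk => h.mul_inner_le hq (by have := Finset.mem_range.1 hk; lia) _
  constructor
  · intro hs k hk
    obtain ⟨q, hqK, hq⟩ := h.exists_mem_inner_eq_mul ⟨p, hp⟩
      (σ := fun k => (SignType.sign (a k - a (k + 1)) : ℝ)) fun k => by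
        rcases lt_trichotomy (a k - a (k + 1)) 0 with h0 | h0 | h0 <;> simp [h0]
    have hle := hs.inner_le q hqK
    rw [h.inner_stepSum_eq a hqK, h.inner_stepSum_eq a hp] at hle
    have saturated : ∑ k ∈ Finset.range (n - 1), (a k - a (k + 1)) * inner ℝ (x (k + 1)) q =
        ∑ k ∈ Finset.range (n - 1), |a k - a (k + 1)| * c (k + 1) := by
      refine Finset.sum_congr rfl fun k hk => ?_
      rw [hq _ (by have := Finset.mem_range.1 hk; lia), ← mul_assoc, self_mul_sign]
    rw [saturated] at hle
    exact (Finset.sum_eq_sum_iff_of_le (bound hp)).1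
      (le_antisymm (Finset.sum_le_sum (bound hp)) hle) k (Finset.mem_range.2 (by lia))
  · intro hs
    refine ⟨hp, fun q hq => ?_⟩
    rw [h.inner_stepSum_eq a hq, h.inner_stepSum_eq a hp]
    refine Finset.sum_le_sum fun k hk => ?_
    rw [hs k (by have := Finset.mem_range.1 hk; lia)]
    exact bound hq k hk

theorem isSupport_stepSum_iff (h : IsConcaveChain K n x t c) (a : ℕ → ℝ) (hp : p ∈ K) :
    IsSupport K (stepSum n x a) p ↔ ∀ k, k + 1 < n →
      (a (k + 1) < a k → inner ℝ (x (k + 1)) p = c (k + 1)) ∧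
      (a k < a (k + 1) → inner ℝ (x (k + 1)) p = -c (k + 1)) := by
  rw [h.isSupport_stepSum_iff_mul_eq a hp]
  refine forall₂_congr fun k _ => ?_
  rcases lt_trichotomy (a k) (a (k + 1)) with hlt | heq | hgt
  · rw [abs_of_neg (sub_neg.2 hlt), neg_mul, ← mul_neg, mul_right_inj' (sub_neg.2 hlt).ne]
    simp [hlt, hlt.le]
  · simp [heq]
  · rw [abs_of_pos (sub_pos.2 hgt), mul_right_inj' (sub_pos.2 hgt).ne']
    simp [hgt, hgt.le]

/-- Where the flux saturates its upper bound, it touches the concave function `c` of `t` from below,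
so its slope cannot increase there. -/
theorem apply_succ_le_of_inner_eq (h : IsConcaveChain K n x t c) {a : ℕ → ℝ}
    (ha : ∀ k ≤ n, |inner ℝ (x k) (stepSum n x a)| ≤ c k) {k : ℕ} (hk : k + 1 < n)
    (hc : inner ℝ (x (k + 1)) (stepSum n x a) = c (k + 1)) : a (k + 1) ≤ a k := by
  have inc₁ := h.inner_succ_sub_inner_stepSum (k := k) (by lia) a
  have inc₂ := h.inner_succ_sub_inner_stepSum hk a
  have le₁ := (le_abs_self _).trans (ha k (by lia))
  have le₂ := (le_abs_self _).trans (ha (k + 1 + 1) (by lia))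
  calc a (k + 1) ≤ (c (k + 2) - c (k + 1)) / (t (k + 2) - t (k + 1)) := by
        rw [le_div_iff₀ (sub_pos.2 (h.lt _ hk))]; linarith
    _ ≤ (c (k + 1) - c k) / (t (k + 1) - t k) := h.concave k hk
    _ ≤ a k := by rw [div_le_iff₀ (sub_pos.2 (h.lt k (by lia)))]; linarith

theorem apply_le_succ_of_inner_eq_neg (h : IsConcaveChain K n x t c) {a : ℕ → ℝ}
    (ha : ∀ k ≤ n, |inner ℝ (x k) (stepSum n x a)| ≤ c k) {k : ℕ} (hk : k + 1 < n)
    (hc : inner ℝ (x (k + 1)) (stepSum n x a) = -c (k + 1)) : a k ≤ a (k + 1) := by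
  refine neg_le_neg_iff.1 (h.apply_succ_le_of_inner_eq (a := -a) (fun j hj => ?_) hk ?_)
  · rw [stepSum_neg, inner_neg_right, abs_neg]
    exact ha j hj
  · rw [stepSum_neg, inner_neg_right, hc, neg_neg]

theorem isSupport_of_isSupport_add_smul (h : IsConcaveChain K n x t c) {ν : ℝ} (hν : 0 ≤ ν)
    {a b : ℕ → ℝ} (hq : IsSupport K (stepSum n x a) (stepSum n x b))
    (hp : IsSupport K (stepSum n x a + ν • stepSum n x b) p) : IsSupport K (stepSum n x a) p := by
  have hb := h.abs_le _ hq.mem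
  have hpK := hp.mem
  rw [stepSum_add_smul, h.isSupport_stepSum_iff _ hpK] at hp
  rw [h.isSupport_stepSum_iff _ hq.mem] at hq
  rw [h.isSupport_stepSum_iff _ hpK]
  refine fun k hk => ⟨fun hlt => (hp k hk).1 ?_, fun hlt => (hp k hk).2 ?_⟩
  · have hle := h.apply_succ_le_of_inner_eq hb hk ((hq k hk).1 hlt)
    exact add_lt_add_of_lt_of_le hlt (mul_le_mul_of_nonneg_left hle hν)
  · have hle := h.apply_le_succ_of_inner_eq_neg hb hk ((hq k hk).2 hlt)
    exact add_lt_add_of_lt_of_le hlt (mul_le_mul_of_nonneg_left hle hν)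

theorem exists_isSupport_add_smul_add (h : IsConcaveChain K n x t c) (hcv : Convex ℝ K)
    {lam ν : ℝ} (hlam : 0 < lam) (hν : 0 < ν) {b : ℕ → ℝ} {w q : H} (hup : IsSupport K u p)
    (hg : stepSum n x b = u + lam • p) (hwq : IsSupport K w q) (hu : u = w + ν • q) :
    ∃ r, IsSupport K w r ∧ stepSum n x b = w + (lam + ν) • r := by
  obtain ⟨d, a, rfl, rfl⟩ := h.exists_eq_stepSum_of_eq_add_smul hlam hup hg
  obtain ⟨e, f, rfl, rfl⟩ := h.exists_eq_stepSum_of_eq_add_smul hν hwq hu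
  have hpos : 0 < lam + ν := add_pos hlam hν
  refine ⟨_, (h.isSupport_of_isSupport_add_smul hν.le hwq (hu ▸ hup)).convexCombination hcv hwq
    (s := lam / (lam + ν)) (t := ν / (lam + ν)) (by positivity) (by positivity)
    (by field_simp), ?_⟩
  rw [hg, hu, smul_add, smul_smul, smul_smul, mul_div_cancel₀ _ hpos.ne',
    mul_div_cancel₀ _ hpos.ne']
  abel

end IsConcaveChain

end Hilbert

variable {N : ℕ}

section Divergence

variable {φ ψ : Euc N → Euc N}

theorem divergence_add_smul (hφ : ContDiff ℝ ∞ φ) (hψ : ContDiff ℝ ∞ ψ) (a b : ℝ) (x : Euc N) :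
    divergence (a • φ + b • ψ) x = a * divergence φ x + b * divergence ψ x := by
  have hφx := hφ.differentiable (by simp) x
  have hψx := hψ.differentiable (by simp) x
  simp only [divergence, Finset.mul_sum, ← Finset.sum_add_distrib]
  rw [fderiv_add (hφx.const_smul a) (hψx.const_smul b), fderiv_const_smul hφx,
    fderiv_const_smul hψx]
  simp

theorem continuous_divergence (hφ : ContDiff ℝ ∞ φ) : Continuous (divergence φ) := by
  have hcont := hφ.continuous_fderiv (by simp)
  unfold divergence
  fun_prop

theorem hasCompactSupport_divergence (hφ : HasCompactSupport φ) :
    HasCompactSupport (divergence φ) := by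
  refine (hφ.fderiv ℝ).mono fun x hx => ?_
  contrapose! hx
  simp only [Function.mem_support, not_not] at hx ⊢
  simp [divergence, hx]

theorem memLp_divergence (hφ : ContDiff ℝ ∞ φ) (hc : HasCompactSupport φ)
    (μ : Measure (Euc N)) [IsFiniteMeasureOnCompacts μ] (p : ℝ≥0∞) : MemLp (divergence φ) p μ :=
  (continuous_divergence hφ).memLp_of_hasCompactSupport (hasCompactSupport_divergence hc)

end Divergence

section DualBall

variable {Ω : Set (Euc N)}

theorem IsTestField.add_smul {φ ψ : Euc N → Euc N} (hφ : IsTestField Ω φ) (hψ : IsTestField Ω ψ)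
    {a b : ℝ} (hab : |a| + |b| ≤ 1) : IsTestField Ω (a • φ + b • ψ) where
  smooth := (hφ.smooth.const_smul a).add (hψ.smooth.const_smul b)
  compactSupport := (hφ.compactSupport.smul_left (f := fun _ => a)).add
    (hψ.compactSupport.smul_left (f := fun _ => b))
  support_subset := (tsupport_add _ _).trans <| Set.union_subset
    ((tsupport_smul_subset_right (fun _ => a) φ).trans hφ.support_subset)
    ((tsupport_smul_subset_right (fun _ => b) ψ).trans hψ.support_subset)
  norm_le_one x hx := calc
    ‖a • φ x + b • ψ x‖ ≤ |a| * ‖φ x‖ + |b| * ‖ψ x‖ := by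
      simpa only [norm_smul, Real.norm_eq_abs] using norm_add_le (a • φ x) (b • ψ x)
    _ ≤ |a| * 1 + |b| * 1 := by
      gcongr
      exacts [hφ.norm_le_one x hx, hψ.norm_le_one x hx]
    _ ≤ 1 := by simpa using hab

theorem isTestField_zero (Ω : Set (Euc N)) : IsTestField Ω 0 where
  smooth := contDiff_const
  compactSupport := HasCompactSupport.zero
  support_subset := by simp [tsupport_zero]
  norm_le_one := by simp

theorem IsTestField.norm_le {φ : Euc N → Euc N} (hφ : IsTestField Ω φ) (x : Euc N) :
    ‖φ x‖ ≤ 1 := by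
  by_cases hx : x ∈ Ω
  · exact hφ.norm_le_one x hx
  · simp [image_eq_zero_of_notMem_tsupport fun h => hx (hφ.support_subset h)]

/-- The classes in `L²(Ω)` of the divergences of test fields. -/
def divergences (Ω : Set (Euc N)) : Set (L2 Ω) :=
  {p | ∃ φ, IsTestField Ω φ ∧ p =ᵐ[volume.restrict Ω] divergence φ}

theorem convex_divergences (Ω : Set (Euc N)) : Convex ℝ (divergences Ω) := by
  rintro p ⟨φ, hφ, hpφ⟩ q ⟨ψ, hψ, hqψ⟩ a b ha hb hab
  refine ⟨a • φ + b • ψ, hφ.add_smul hψ (by rw [abs_of_nonneg ha, abs_of_nonneg hb, hab]), ?_⟩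
  filter_upwards [Lp.coeFn_add (a • p) (b • q), Lp.coeFn_smul a p, Lp.coeFn_smul b q, hpφ, hqψ]
    with x hadd hp hq hpx hqx
  rw [divergence_add_smul hφ.smooth hψ.smooth, hadd, Pi.add_apply, hp, hq, Pi.smul_apply,
    Pi.smul_apply, hpx, hqx, smul_eq_mul, smul_eq_mul]

theorem zero_mem_divergences (Ω : Set (Euc N)) : (0 : L2 Ω) ∈ divergences Ω := by
  refine ⟨0, isTestField_zero Ω, ?_⟩
  filter_upwards [Lp.coeFn_zero ℝ 2 (volume.restrict Ω)] with x hx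
  rw [hx]
  simp [divergence]

theorem IsTestField.exists_mem_divergences {φ : Euc N → Euc N} (hφ : IsTestField Ω φ) :
    ∃ p ∈ divergences Ω, p =ᵐ[volume.restrict Ω] divergence φ :=
  have hmem := memLp_divergence hφ.smooth hφ.compactSupport (volume.restrict Ω) 2
  ⟨hmem.toLp, ⟨φ, hφ, hmem.coeFn_toLp⟩, hmem.coeFn_toLp⟩

/-- The closed convex subset of `L²(Ω)` whose support function is the total variation. -/
def dualBall (Ω : Set (Euc N)) : Set (L2 Ω) :=
  closure (divergences Ω)

theorem divergences_subset_dualBall (Ω : Set (Euc N)) : divergences Ω ⊆ dualBall Ω :=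
  subset_closure

theorem isClosed_dualBall (Ω : Set (Euc N)) : IsClosed (dualBall Ω) :=
  isClosed_closure

theorem convex_dualBall (Ω : Set (Euc N)) : Convex ℝ (dualBall Ω) :=
  (convex_divergences Ω).closure

theorem zero_mem_dualBall (Ω : Set (Euc N)) : (0 : L2 Ω) ∈ dualBall Ω :=
  divergences_subset_dualBall Ω (zero_mem_divergences Ω)

theorem forall_mem_dualBall_of_isClosed {P : L2 Ω → Prop} (hP : IsClosed {p | P p})
    (h : ∀ φ, IsTestField Ω φ → ∀ p : L2 Ω, p =ᵐ[volume.restrict Ω] divergence φ → P p) :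
    ∀ p ∈ dualBall Ω, P p :=
  closure_minimal (fun p ⟨φ, hφ, hp⟩ => h φ hφ p hp) hP

theorem inner_eq_setIntegral_mul {u p : L2 Ω} {f : Euc N → ℝ} (hf : p =ᵐ[volume.restrict Ω] f) :
    inner ℝ u p = ∫ x in Ω, u x * f x := by
  rw [L2.inner_def]
  refine integral_congr_ae ?_
  filter_upwards [hf] with x hx
  rw [← hx]
  simp [mul_comm]

theorem ofReal_inner_le_TV (u : L2 Ω) {p : L2 Ω} (hp : p ∈ dualBall Ω) :
    ENNReal.ofReal (inner ℝ u p) ≤ TV Ω u := by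
  refine forall_mem_dualBall_of_isClosed (P := fun p => ENNReal.ofReal (inner ℝ u p) ≤ TV Ω u)
    (isClosed_le (ENNReal.continuous_ofReal.comp (by fun_prop)) continuous_const)
    (fun φ hφ p hp => ?_) p hp
  rw [inner_eq_setIntegral_mul hp]
  exact le_iSup₂_of_le φ hφ le_rfl

theorem inner_le_toReal_TV {u p : L2 Ω} (hu : TV Ω u ≠ ⊤) (hp : p ∈ dualBall Ω) :
    inner ℝ u p ≤ (TV Ω u).toReal :=
  (ENNReal.ofReal_le_iff_le_toReal hu).1 (ofReal_inner_le_TV u hp)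

theorem IsSupport.TV_eq {u p : L2 Ω} (h : IsSupport (dualBall Ω) u p) :
    TV Ω u = ENNReal.ofReal (inner ℝ u p) := by
  refine le_antisymm (iSup₂_le fun φ hφ => ENNReal.ofReal_le_ofReal ?_)
    (ofReal_inner_le_TV u h.mem)
  obtain ⟨q, hq, hqφ⟩ := hφ.exists_mem_divergences
  rw [← inner_eq_setIntegral_mul hqφ]
  exact h.inner_le q (divergences_subset_dualBall Ω hq)

theorem IsSupport.inner_nonneg {u p : L2 Ω} (h : IsSupport (dualBall Ω) u p) :
    0 ≤ inner ℝ u p := by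
  simpa using h.inner_le 0 (zero_mem_dualBall Ω)

theorem exists_isSupport_dualBall (Ω : Set (Euc N)) {ν : ℝ} (hν : 0 < ν) (g : L2 Ω) :
    ∃ u p, IsSupport (dualBall Ω) u p ∧ g = u + ν • p :=
  exists_isSupport_add_smul ⟨0, zero_mem_dualBall Ω⟩ (isClosed_dualBall Ω) (convex_dualBall Ω) hν g

theorem IsSupport.mem_subdiffTV {u p : L2 Ω} (h : IsSupport (dualBall Ω) u p) :
    p ∈ subdiffTV Ω u := by
  refine ⟨by rw [h.TV_eq]; exact ENNReal.ofReal_lt_top, fun v => ?_⟩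
  refine le_trans ?_ (EReal.coe_ennreal_le_coe_ennreal_iff.2 (ofReal_inner_le_TV v h.mem))
  rw [h.TV_eq, EReal.coe_ennreal_ofReal, EReal.coe_ennreal_ofReal, max_eq_left h.inner_nonneg,
    ← EReal.coe_add, EReal.coe_le_coe_iff, inner_sub_right, real_inner_comm u p,
    real_inner_comm v p, add_sub_cancel]
  exact le_max_left _ _

theorem toReal_TV_add_inner_le {u p v : L2 Ω} (h : p ∈ subdiffTV Ω u) (hv : TV Ω v < ⊤) :
    (TV Ω u).toReal + inner ℝ p (v - u) ≤ (TV Ω v).toReal := by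
  have hle := h.2 v
  rwa [← ENNReal.ofReal_toReal h.1.ne, ← ENNReal.ofReal_toReal hv.ne, EReal.coe_ennreal_ofReal,
    EReal.coe_ennreal_ofReal, max_eq_left ENNReal.toReal_nonneg,
    max_eq_left ENNReal.toReal_nonneg, ← EReal.coe_add, EReal.coe_le_coe_iff] at hle

theorem inner_sub_nonneg_of_mem_subdiffTV {u p v q : L2 Ω} (hp : p ∈ subdiffTV Ω u)
    (hq : q ∈ subdiffTV Ω v) : 0 ≤ inner ℝ (p - q) (u - v) := by
  have huv := toReal_TV_add_inner_le hp hq.1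
  have hvu := toReal_TV_add_inner_le hq hp.1
  rw [← neg_sub u v, inner_neg_right] at huv
  rw [inner_sub_left]
  linarith

theorem mem_subdiffTV_iff {u p : L2 Ω} : p ∈ subdiffTV Ω u ↔ IsSupport (dualBall Ω) u p := by
  refine ⟨fun hp => ?_, IsSupport.mem_subdiffTV⟩
  -- the resolvent decomposition `u + p = v + q` coincides with `(u, p)` by monotonicity
  obtain ⟨v, q, hvq, hsum⟩ := exists_isSupport_dualBall Ω one_pos (u + p)
  have hpq : p - q = -(u - v) := by
    rw [one_smul] at hsum
    rw [neg_sub, sub_eq_sub_iff_add_eq_add, add_comm p u, hsum]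
  have hmono := inner_sub_nonneg_of_mem_subdiffTV hp hvq.mem_subdiffTV
  rw [hpq, inner_neg_left, neg_nonneg, real_inner_self_nonpos] at hmono
  rw [hmono, neg_zero] at hpq
  rwa [sub_eq_zero.1 hmono, sub_eq_zero.1 hpq]

end DualBall

section Minimizers

variable {Ω : Set (Euc N)} {ν : ℝ} {g u p v : L2 Ω}

theorem TV_congr {u v : Euc N → ℝ} (h : u =ᵐ[volume.restrict Ω] v) : TV Ω u = TV Ω v := by
  refine iSup_congr fun φ => iSup_congr fun _ => congrArg _ (integral_congr_ae ?_)
  filter_upwards [h] with x hx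
  rw [hx]

theorem energy_congr {g u v : Euc N → ℝ} (h : u =ᵐ[volume.restrict Ω] v) :
    energy Ω ν g u = energy Ω ν g v := by
  rw [energy, energy, TV_congr h, lintegral_congr_ae]
  filter_upwards [h] with x hx
  rw [hx]

theorem lintegral_enorm_sub_sq (u g : L2 Ω) :
    ∫⁻ x in Ω, ‖u x - g x‖ₑ ^ 2 = ENNReal.ofReal (‖u - g‖ ^ 2) := by
  rw [ENNReal.ofReal_pow (norm_nonneg _), ofReal_norm, Lp.enorm_def]
  have hpow := eLpNorm_nnreal_pow_eq_lintegral (f := ⇑(u - g)) (μ := volume.restrict Ω)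
    (two_ne_zero (α := NNReal))
  simp only [ENNReal.coe_ofNat, NNReal.coe_ofNat, ENNReal.rpow_ofNat] at hpow
  rw [hpow]
  refine lintegral_congr_ae ?_
  filter_upwards [Lp.coeFn_sub u g] with x hx
  rw [hx, Pi.sub_apply]

theorem energy_eq_ofReal {t : ℝ} (hν : 0 ≤ ν) (ht : 0 ≤ t) (htv : TV Ω u = ENNReal.ofReal t) :
    energy Ω ν g u = ENNReal.ofReal (ν * t + 2⁻¹ * ‖u - g‖ ^ 2) := by
  rw [energy, htv, lintegral_enorm_sub_sq, ENNReal.ofReal_add (by positivity) (by positivity),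
    ENNReal.ofReal_mul hν, ENNReal.ofReal_mul (by positivity), ENNReal.ofReal_inv_of_pos (by simp)]
  simp

theorem memLp_of_energy_ne_top {v : Euc N → ℝ}
    (hv : AEStronglyMeasurable v (volume.restrict Ω)) (h : energy Ω ν g v ≠ ⊤) :
    MemLp v 2 (volume.restrict Ω) := by
  have hfin : ∫⁻ x in Ω, ‖v x - g x‖ₑ ^ 2 < ⊤ := by
    refine lt_top_iff_ne_top.2 fun htop => h ?_
    rw [energy, htop, ENNReal.mul_top (by simp), add_top]
  have hsub : MemLp (fun x => v x - g x) 2 (volume.restrict Ω) := by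
    refine ⟨hv.sub (Lp.aestronglyMeasurable g), ?_⟩
    rw [eLpNorm_lt_top_iff_lintegral_rpow_enorm_lt_top (by simp) (by simp)]
    simpa using hfin
  exact (hsub.add (Lp.memLp g)).congr_norm hv (.of_forall fun x => by simp)

theorem IsSupport.energy_add_le (h : IsSupport (dualBall Ω) u p) (hν : 0 < ν) (v : L2 Ω) :
    energy Ω ν (u + ν • p : L2 Ω) u + ENNReal.ofReal (2⁻¹ * ‖v - u‖ ^ 2) ≤
      energy Ω ν (u + ν • p : L2 Ω) v := by
  by_cases hv : TV Ω v = ⊤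
  · simp [energy, hv, hν]
  rw [energy_eq_ofReal hν.le h.inner_nonneg h.TV_eq, energy_eq_ofReal hν.le ENNReal.toReal_nonneg
    (ENNReal.ofReal_toReal hv).symm, ← ENNReal.ofReal_add
    (add_nonneg (mul_nonneg hν.le h.inner_nonneg) (by positivity)) (by positivity)]
  refine ENNReal.ofReal_le_ofReal ?_
  rw [show v - (u + ν • p) = (v - u) - ν • p by abel, show u - (u + ν • p) = -(ν • p) by abel,
    norm_neg, norm_sub_sq_real (v - u), real_inner_smul_right, inner_sub_left]
  linarith [mul_le_mul_of_nonneg_left (inner_le_toReal_TV hv h.mem) hν.le]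

variable [IsFiniteMeasure (volume.restrict Ω)]

theorem IsSupport.isMinimizer (h : IsSupport (dualBall Ω) u p) (hν : 0 < ν) :
    IsMinimizer Ω ν (u + ν • p) u where
  memBV := ⟨(Lp.memLp u).integrable one_le_two, by rw [h.TV_eq]; exact ENNReal.ofReal_lt_top⟩
  le v hv := by
    by_cases htop : energy Ω ν (u + ν • p : L2 Ω) v = ⊤
    · exact htop ▸ le_top
    have hv₂ := memLp_of_energy_ne_top hv.integrable.aestronglyMeasurable htop
    rw [← energy_congr hv₂.coeFn_toLp]
    exact le_self_add.trans (h.energy_add_le hν _)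

theorem IsSupport.eq_of_isMinimizer (h : IsSupport (dualBall Ω) u p) (hν : 0 < ν)
    (hv : IsMinimizer Ω ν (u + ν • p) v) : v = u := by
  have hle := (h.energy_add_le hν v).trans (hv.le u (h.isMinimizer hν).memBV)
  rw [energy_eq_ofReal hν.le h.inner_nonneg h.TV_eq] at hle
  have hzero : ENNReal.ofReal (2⁻¹ * ‖v - u‖ ^ 2) ≤ 0 :=
    (ENNReal.add_le_add_iff_left ENNReal.ofReal_ne_top).1 (by simpa using hle)
  have hsq : 2⁻¹ * ‖v - u‖ ^ 2 ≤ 0 := ENNReal.ofReal_eq_zero.1 (le_zero_iff.1 hzero)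
  rw [← sub_eq_zero, ← norm_eq_zero, ← sq_eq_zero_iff]
  linarith [sq_nonneg ‖v - u‖]

theorem isMinimizer_iff_exists_isSupport (hν : 0 < ν) :
    IsMinimizer Ω ν g u ↔ ∃ p, IsSupport (dualBall Ω) u p ∧ g = u + ν • p := by
  constructor
  · intro hu
    obtain ⟨w, p, hp, rfl⟩ := exists_isSupport_dualBall Ω hν g
    rw [hp.eq_of_isMinimizer hν hu]
    exact ⟨p, hp, rfl⟩
  · rintro ⟨p, hp, rfl⟩
    exact hp.isMinimizer hν

theorem isMinimizer_T (hν : 0 < ν) (g : L2 Ω) : IsMinimizer Ω ν g (T Ω ν g) := by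
  obtain ⟨u, p, hp⟩ := exists_isSupport_dualBall Ω hν g
  have hex : ∃ u, IsMinimizer Ω ν g u := ⟨u, (isMinimizer_iff_exists_isSupport hν).2 ⟨p, hp⟩⟩
  rw [T, if_neg hν.ne', dif_pos hex]
  exact hex.choose_spec

theorem eq_T_iff_exists_isSupport (hν : 0 < ν) :
    u = T Ω ν g ↔ ∃ p, IsSupport (dualBall Ω) u p ∧ g = u + ν • p := by
  refine ⟨?_, ?_⟩
  · rintro rfl
    exact (isMinimizer_iff_exists_isSupport hν).1 (isMinimizer_T hν g)
  · rintro ⟨p, hp, rfl⟩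
    exact (hp.eq_of_isMinimizer hν (isMinimizer_T hν _)).symm

theorem isMinimizer_iff_eq_T (hν : 0 < ν) : IsMinimizer Ω ν g u ↔ u = T Ω ν g := by
  rw [isMinimizer_iff_exists_isSupport hν, eq_T_iff_exists_isSupport hν]

theorem eq_T_iff_exists_mem_subdiffTV (hν : 0 < ν) :
    u = T Ω ν g ↔ ∃ p ∈ subdiffTV Ω u, g = u + ν • p := by
  simp only [eq_T_iff_exists_isSupport hν, mem_subdiffTV_iff]

theorem continuous_T (hν : 0 < ν) : Continuous (T Ω ν) := by
  refine LipschitzWith.continuous (K := 1) (LipschitzWith.of_dist_le_mul fun g g' => ?_)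
  obtain ⟨p, hp, hg⟩ := (eq_T_iff_exists_isSupport hν).1 (Eq.refl (T Ω ν g))
  obtain ⟨p', hp', hg'⟩ := (eq_T_iff_exists_isSupport hν).1 (Eq.refl (T Ω ν g'))
  rw [dist_eq_norm, dist_eq_norm, NNReal.coe_one, one_mul]
  refine (hp.norm_sub_le hp' hν.le).trans_eq ?_
  rw [← hg, ← hg']

end Minimizers

section IntegrationByParts

theorem integral_mul_fderiv_eq_neg_of_hasCompactSupport {E : Type*} [NormedAddCommGroup E]
    [NormedSpace ℝ E] [FiniteDimensional ℝ E] [MeasurableSpace E] [BorelSpace E]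
    {μ : Measure E} [μ.IsAddHaarMeasure] {η f : E → ℝ} (hη : ContDiff ℝ 1 η)
    (hf : ContDiff ℝ 1 f) (hc : HasCompactSupport f) (v : E) :
    ∫ x, η x * fderiv ℝ f x v ∂μ = -∫ x, fderiv ℝ η x v * f x ∂μ := by
  have hηc := hη.continuous
  have hfc := hf.continuous
  have hint {k : E → ℝ} (hk : Continuous k) (h0 : ∀ x ∉ tsupport f, k x = 0) :
      Integrable k μ :=
    hk.integrable_of_hasCompactSupport (.intro hc h0)
  refine integral_mul_fderiv_eq_neg_fderiv_mul_of_integrable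
    (hint (by fun_prop) fun x hx => ?_) (hint (by fun_prop) fun x hx => ?_)
    (hint (by fun_prop) fun x hx => ?_) (fun x _ => hη.differentiable one_ne_zero x)
    (fun x _ => hf.differentiable one_ne_zero x)
  · rw [image_eq_zero_of_notMem_tsupport hx, mul_zero]
  · rw [fderiv_of_notMem_tsupport ℝ hx, zero_apply, mul_zero]
  · rw [image_eq_zero_of_notMem_tsupport hx, mul_zero]

theorem fderiv_coord_apply {φ : Euc N → Euc N} {x : Euc N} (hφ : DifferentiableAt ℝ φ x)
    (v : Euc N) (i : Fin N) : fderiv ℝ (fun y => φ y i) x v = fderiv ℝ φ x v i :=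
  congrArg (· v) ((EuclideanSpace.proj i : Euc N →L[ℝ] ℝ).hasFDerivAt.comp x
    hφ.hasFDerivAt).fderiv

theorem sum_apply_single_mul (L : Euc N →L[ℝ] ℝ) (y : Euc N) :
    ∑ i, L (EuclideanSpace.single i 1) * y i = L y := by
  conv_rhs => rw [← (EuclideanSpace.basisFun (Fin N) ℝ).sum_repr y, map_sum]
  simp [mul_comm]

theorem integral_mul_divergence {η : Euc N → ℝ} {φ : Euc N → Euc N} (hη : ContDiff ℝ 1 η)
    (hφ : ContDiff ℝ 1 φ) (hc : HasCompactSupport φ) :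
    ∫ x, η x * divergence φ x = -∫ x, fderiv ℝ η x (φ x) := by
  have hcoord (i : Fin N) : ContDiff ℝ 1 fun y => φ y i :=
    (EuclideanSpace.proj i : Euc N →L[ℝ] ℝ).contDiff.comp hφ
  have hcoord_supp (i : Fin N) : HasCompactSupport fun y => φ y i :=
    hc.comp_left (g := fun y : Euc N => y i) rfl
  have hηc := hη.continuous
  have hφc := hφ.continuous
  have hleft (i : Fin N) :
      Integrable fun x => η x * fderiv ℝ φ x (EuclideanSpace.single i 1) i :=
    Continuous.integrable_of_hasCompactSupport (by fun_prop) <| .intro hc fun x hx => by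
      simp [fderiv_of_notMem_tsupport ℝ hx]
  have hright (i : Fin N) :
      Integrable fun x => fderiv ℝ η x (EuclideanSpace.single i 1) * φ x i :=
    Continuous.integrable_of_hasCompactSupport (by fun_prop) <| .intro hc fun x hx => by
      simp [image_eq_zero_of_notMem_tsupport hx]
  simp_rw [divergence, Finset.mul_sum, fun x => (sum_apply_single_mul (fderiv ℝ η x) (φ x)).symm]
  rw [integral_finsetSum _ fun i _ => hleft i, integral_finsetSum _ fun i _ => hright i,
    ← Finset.sum_neg_distrib]
  refine Finset.sum_congr rfl fun i _ => ?_
  simp only [← fderiv_coord_apply (hφ.differentiable one_ne_zero _)]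
  exact integral_mul_fderiv_eq_neg_of_hasCompactSupport hη (hcoord i) (hcoord_supp i) _

theorem integral_divergence {φ : Euc N → Euc N} (hφ : ContDiff ℝ 1 φ)
    (hc : HasCompactSupport φ) : ∫ x, divergence φ x = 0 := by
  simpa using integral_mul_divergence (η := fun _ => 1) contDiff_const hφ hc

end IntegrationByParts

section PolarCoordinates

/-- The volume of the unit ball of `ℝ^N`. -/
noncomputable def unitBallVolume (N : ℕ) : ℝ :=
  volume.real (Metric.ball (0 : Euc N) 1)

/-- The perimeter of a ball of radius `r` in `ℝ^N`. -/
noncomputable def perimeter (N : ℕ) (r : ℝ) : ℝ :=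
  N * unitBallVolume N * r ^ (N - 1)

theorem unitBallVolume_pos (N : ℕ) : 0 < unitBallVolume N :=
  ENNReal.toReal_pos (Metric.measure_ball_pos _ _ one_pos).ne' measure_ball_lt_top.ne

variable [NeZero N]

theorem volume_real_ball {r : ℝ} (hr : 0 ≤ r) :
    volume.real (Metric.ball (0 : Euc N) r) = unitBallVolume N * r ^ N := by
  rw [Measure.real, Measure.addHaar_ball _ _ hr, ENNReal.toReal_mul, mul_comm,
    ENNReal.toReal_ofReal (by positivity), finrank_euclideanSpace_fin]
  rfl

theorem integral_comp_norm (f : ℝ → ℝ) :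
    ∫ x : Euc N, f ‖x‖ = N * unitBallVolume N * ∫ t in Set.Ioi 0, t ^ (N - 1) * f t := by
  simpa [unitBallVolume, mul_assoc] using
    integral_fun_norm_addHaar (volume : Measure (Euc N)) f

theorem setIntegral_ball_comp_norm (f : ℝ → ℝ) {r : ℝ} (hr : 0 ≤ r) :
    ∫ x in Metric.ball (0 : Euc N) r, f ‖x‖ =
      N * unitBallVolume N * ∫ t in 0..r, t ^ (N - 1) * f t := by
  have hball (x : Euc N) : (Metric.ball 0 r).indicator (fun x => f ‖x‖) x =
      (Set.Iio r).indicator f ‖x‖ := by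
    simp [Set.indicator]
  have hIio (t : ℝ) : t ^ (N - 1) * (Set.Iio r).indicator f t =
      (Set.Iio r).indicator (fun t => t ^ (N - 1) * f t) t := by
    simp [Set.indicator]
  rw [← integral_indicator measurableSet_ball]
  simp only [hball]
  rw [integral_comp_norm]
  simp only [hIio]
  rw [setIntegral_indicator measurableSet_Iio, Set.Ioi_inter_Iio,
    intervalIntegral.integral_of_le hr, integral_Ioc_eq_integral_Ioo]

end PolarCoordinates

section Flux

theorem hasDerivAt_smoothTransition (y : ℝ) :
    HasDerivAt Real.smoothTransition (deriv Real.smoothTransition y) y :=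
  ((Real.smoothTransition.contDiff (n := 1)).differentiable one_ne_zero y).hasDerivAt

theorem continuous_deriv_smoothTransition : Continuous (deriv Real.smoothTransition) :=
  (Real.smoothTransition.contDiff (n := 1)).continuous_deriv le_rfl

theorem deriv_smoothTransition_of_nonpos {y : ℝ} (hy : y ≤ 0) :
    deriv Real.smoothTransition y = 0 :=
  IsLocalMin.deriv_eq_zero <| .of_forall fun z => by
    rw [Real.smoothTransition.zero_of_nonpos hy]
    exact Real.smoothTransition.nonneg z

theorem tendsto_smoothTransition_nat_mul (y : ℝ) :
    Filter.Tendsto (fun j : ℕ => Real.smoothTransition (j * y)) Filter.atTop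
      (nhds (if 0 < y then 1 else 0)) := by
  split_ifs with hy
  · refine tendsto_const_nhds.congr' ?_
    have hlarge := (tendsto_natCast_atTop_atTop (R := ℝ)).atTop_mul_const hy
    filter_upwards [hlarge.eventually_ge_atTop 1] with j hj
    exact (Real.smoothTransition.one_of_one_le hj).symm
  · refine tendsto_const_nhds.congr fun j => ?_
    exact (Real.smoothTransition.zero_of_nonpos
      (mul_nonpos_of_nonneg_of_nonpos j.cast_nonneg (not_lt.1 hy))).symm

/-- A smooth approximation, as `s → ∞`, of the indicator function of the ball of radius `r`. -/
noncomputable def ballCutoff (r s : ℝ) (x : Euc N) : ℝ :=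
  Real.smoothTransition (s * (r ^ 2 - ‖x‖ ^ 2))

/-- The norm of the gradient of `ballCutoff r s` at distance `t` from the origin. -/
noncomputable def ballCutoffSlope (r s t : ℝ) : ℝ :=
  s * (2 * t) * deriv Real.smoothTransition (s * (r ^ 2 - t ^ 2))

variable {r s t : ℝ}

theorem contDiff_ballCutoff {n : ℕ∞} : ContDiff ℝ n (ballCutoff (N := N) r s) :=
  Real.smoothTransition.contDiff.comp
    (contDiff_const.mul (contDiff_const.sub (contDiff_norm_sq ℝ)))

theorem tendsto_ballCutoff (hr : 0 < r) (x : Euc N) :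
    Filter.Tendsto (fun j : ℕ => ballCutoff r j x) Filter.atTop
      (nhds ((Metric.ball (0 : Euc N) r).indicator 1 x)) := by
  have hmem : x ∈ Metric.ball 0 r ↔ 0 < r ^ 2 - ‖x‖ ^ 2 := by
    rw [mem_ball_zero_iff, sub_pos, sq_lt_sq₀ (norm_nonneg _) hr.le]
  simpa only [ballCutoff, Set.indicator, hmem, Pi.one_apply] using
    tendsto_smoothTransition_nat_mul (r ^ 2 - ‖x‖ ^ 2)

theorem continuous_ballCutoffSlope : Continuous (ballCutoffSlope r s) := by
  have := continuous_deriv_smoothTransition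
  unfold ballCutoffSlope
  fun_prop

theorem ballCutoffSlope_nonneg (hs : 0 ≤ s) (ht : 0 ≤ t) : 0 ≤ ballCutoffSlope r s t :=
  mul_nonneg (by positivity) Real.smoothTransition.monotone.deriv_nonneg

theorem ballCutoffSlope_of_le (hr : 0 ≤ r) (hs : 0 ≤ s) (ht : r ≤ t) :
    ballCutoffSlope r s t = 0 := by
  rw [ballCutoffSlope, deriv_smoothTransition_of_nonpos, mul_zero]
  exact mul_nonpos_of_nonneg_of_nonpos hs (by nlinarith)

theorem integral_ballCutoffSlope_le : ∫ t in 0..r, ballCutoffSlope r s t ≤ 1 := by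
  have hderiv (t : ℝ) : HasDerivAt (fun t => -Real.smoothTransition (s * (r ^ 2 - t ^ 2)))
      (ballCutoffSlope r s t) t := by
    have hinner : HasDerivAt (fun t : ℝ => s * (r ^ 2 - t ^ 2)) (s * (-(2 * t))) t := by
      simpa using (((hasDerivAt_id t).pow 2).const_sub (r ^ 2)).const_mul s
    refine ((hasDerivAt_smoothTransition _).comp t hinner).neg.congr_deriv ?_
    rw [ballCutoffSlope]
    ring
  rw [intervalIntegral.integral_eq_sub_of_hasDerivAt (fun t _ => hderiv t)
    (continuous_ballCutoffSlope.intervalIntegrable _ _)]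
  simpa [Real.smoothTransition.zero] using Real.smoothTransition.le_one (s * r ^ 2)

theorem neg_fderiv_ballCutoff_le (hs : 0 ≤ s) {x v : Euc N} (hv : ‖v‖ ≤ 1) :
    -fderiv ℝ (ballCutoff r s) x v ≤ ballCutoffSlope r s ‖x‖ := by
  have hinner : HasFDerivAt (fun x : Euc N => s * (r ^ 2 - ‖x‖ ^ 2))
      (s • -((2 : ℕ) • innerSL ℝ x : Euc N →L[ℝ] ℝ)) x :=
    ((hasStrictFDerivAt_norm_sq x).hasFDerivAt.const_sub (r ^ 2)).const_mul s
  have hfderiv := ((hasDerivAt_smoothTransition _).comp_hasFDerivAt x hinner).fderiv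
  change fderiv ℝ (ballCutoff r s) x = _ at hfderiv
  have hv' : inner ℝ x v ≤ ‖x‖ :=
    (real_inner_le_norm x v).trans (mul_le_of_le_one_right (norm_nonneg x) hv)
  calc -fderiv ℝ (ballCutoff r s) x v
      = s * (2 * inner ℝ x v) * deriv Real.smoothTransition (s * (r ^ 2 - ‖x‖ ^ 2)) := by
        rw [hfderiv]
        simp
        ring
    _ ≤ ballCutoffSlope r s ‖x‖ := by
        rw [ballCutoffSlope]
        gcongr
        exact Real.smoothTransition.monotone.deriv_nonneg

theorem integral_ballCutoffSlope_norm_le [NeZero N] (hr : 0 < r) (hs : 0 ≤ s) :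
    ∫ x : Euc N, ballCutoffSlope r s ‖x‖ ≤ perimeter N r := by
  have hsupp : ∫ t in Set.Ioi 0, t ^ (N - 1) * ballCutoffSlope r s t =
      ∫ t in 0..r, t ^ (N - 1) * ballCutoffSlope r s t := by
    rw [intervalIntegral.integral_of_le hr.le]
    refine setIntegral_eq_of_subset_of_forall_sdiff_eq_zero measurableSet_Ioi
      Set.Ioc_subset_Ioi_self fun t ⟨ht, htr⟩ => ?_
    rw [ballCutoffSlope_of_le hr.le hs (not_le.1 fun h => htr ⟨ht, h⟩).le, mul_zero]
  have hbound : ∫ t in 0..r, t ^ (N - 1) * ballCutoffSlope r s t ≤ r ^ (N - 1) := calc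
    _ ≤ ∫ t in 0..r, r ^ (N - 1) * ballCutoffSlope r s t := by
      have hcont := continuous_ballCutoffSlope (r := r) (s := s)
      refine intervalIntegral.integral_mono_on hr.le
        (Continuous.intervalIntegrable (by fun_prop) _ _)
        (Continuous.intervalIntegrable (by fun_prop) _ _) fun t ht => ?_
      have := ballCutoffSlope_nonneg (r := r) hs ht.1
      have := ht.1
      gcongr
      exact ht.2
    _ ≤ r ^ (N - 1) := by
      rw [intervalIntegral.integral_const_mul]
      exact mul_le_of_le_one_right (by positivity) integral_ballCutoffSlope_le
  rw [integral_comp_norm, hsupp, perimeter]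
  have := unitBallVolume_pos N
  gcongr

theorem integral_ballCutoff_mul_divergence_le [NeZero N] {φ : Euc N → Euc N}
    (hφ : ContDiff ℝ ∞ φ) (hc : HasCompactSupport φ) (hnorm : ∀ x, ‖φ x‖ ≤ 1) (hr : 0 < r)
    (hs : 0 ≤ s) : ∫ x, ballCutoff r s x * divergence φ x ≤ perimeter N r := by
  have hcutoff := (contDiff_ballCutoff (N := N) (r := r) (s := s) (n := 1))
  have hcont := (hcutoff.continuous_fderiv one_ne_zero).clm_apply hφ.continuous
  have hslope : Continuous fun x : Euc N => ballCutoffSlope r s ‖x‖ :=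
    continuous_ballCutoffSlope.comp continuous_norm
  rw [integral_mul_divergence hcutoff (hφ.of_le (by simp)) hc, ← integral_neg]
  refine (integral_mono ?_ ?_ fun x => neg_fderiv_ballCutoff_le hs (hnorm x)).trans
    (integral_ballCutoffSlope_norm_le hr hs)
  · exact (hcont.integrable_of_hasCompactSupport <| .intro hc fun x hx => by
      simp [image_eq_zero_of_notMem_tsupport hx]).neg
  · refine hslope.integrable_of_hasCompactSupport <|
      .intro (isCompact_closedBall 0 r) fun x hx => ?_
    exact ballCutoffSlope_of_le hr.le hs (by simpa using (not_le.1 (by simpa using hx)).le)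

theorem setIntegral_ball_divergence_le [NeZero N] {φ : Euc N → Euc N} (hφ : ContDiff ℝ ∞ φ)
    (hc : HasCompactSupport φ) (hnorm : ∀ x, ‖φ x‖ ≤ 1) (hr : 0 < r) :
    ∫ x in Metric.ball 0 r, divergence φ x ≤ perimeter N r := by
  have hdiv := continuous_divergence hφ
  have hint : Integrable (divergence φ) :=
    hdiv.integrable_of_hasCompactSupport (hasCompactSupport_divergence hc)
  have hlim : Filter.Tendsto (fun j : ℕ => ∫ x, ballCutoff r j x * divergence φ x) Filter.atTop
      (nhds (∫ x in Metric.ball 0 r, divergence φ x)) := by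
    rw [← integral_indicator measurableSet_ball]
    refine tendsto_integral_of_dominated_convergence (fun x => ‖divergence φ x‖)
      (fun j => ((contDiff_ballCutoff (n := 1)).continuous.mul hdiv).aestronglyMeasurable)
      hint.norm (fun j => .of_forall fun x => ?_) (.of_forall fun x => ?_)
    · rw [norm_mul, ballCutoff, Real.norm_of_nonneg (Real.smoothTransition.nonneg _)]
      exact mul_le_of_le_one_left (norm_nonneg _) (Real.smoothTransition.le_one _)
    · have := (tendsto_ballCutoff hr x).mul_const (divergence φ x)
      simpa only [← Set.indicator_mul_left, Pi.one_apply, one_mul] using this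
  exact le_of_tendsto' hlim fun j =>
    integral_ballCutoff_mul_divergence_le hφ hc hnorm hr j.cast_nonneg

theorem abs_setIntegral_ball_divergence_le [NeZero N] {φ : Euc N → Euc N}
    (hφ : ContDiff ℝ ∞ φ) (hc : HasCompactSupport φ) (hnorm : ∀ x, ‖φ x‖ ≤ 1) (hr : 0 < r) :
    |∫ x in Metric.ball 0 r, divergence φ x| ≤ perimeter N r := by
  refine abs_le'.2 ⟨setIntegral_ball_divergence_le hφ hc hnorm hr, ?_⟩
  have hneg (x : Euc N) : divergence (-φ) x = -divergence φ x := by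
    simpa using divergence_add_smul hφ hφ (-1) 0 x
  simpa only [hneg, integral_neg] using
    setIntegral_ball_divergence_le (φ := -φ) hφ.neg hc.neg (by simpa using hnorm) hr

end Flux

section BallIndicator

variable {R r : ℝ}

/-- The class in `L²(B(0, R))` of the indicator function of `B(0, r)`. -/
noncomputable def ballIndicator (N : ℕ) (R r : ℝ) : L2 (Metric.ball (0 : Euc N) R) :=
  indicatorConstLp 2 (measurableSet_ball : MeasurableSet (Metric.ball (0 : Euc N) r))
    ((Measure.restrict_apply_le _ _).trans_lt measure_ball_lt_top).ne 1

theorem coeFn_ballIndicator (R r : ℝ) :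
    ballIndicator N R r =ᵐ[volume.restrict (Metric.ball 0 R)]
      fun x => if ‖x‖ < r then 1 else 0 := by
  filter_upwards [indicatorConstLp_coeFn (p := 2) (c := (1 : ℝ)) (hs := measurableSet_ball)
    (hμs := ((Measure.restrict_apply_le (Metric.ball (0 : Euc N) R) _).trans_lt
      (measure_ball_lt_top (x := (0 : Euc N)) (r := r))).ne)] with x hx
  simpa [ballIndicator, Set.indicator] using hx

theorem ballIndicator_zero (R : ℝ) : ballIndicator N R 0 = 0 := by
  simp [ballIndicator]

theorem inner_ballIndicator_of_ae {p : L2 (Metric.ball (0 : Euc N) R)} {f : Euc N → ℝ}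
    (hr : r ≤ R) (hp : p =ᵐ[volume.restrict (Metric.ball 0 R)] f) :
    inner ℝ (ballIndicator N R r) p = ∫ x in Metric.ball 0 r, f x := by
  have hsub := Metric.ball_subset_ball (x := (0 : Euc N)) hr
  rw [ballIndicator, L2.inner_indicatorConstLp_one, Measure.restrict_restrict measurableSet_ball,
    Set.inter_eq_left.2 hsub]
  exact integral_congr_ae (ae_restrict_of_ae_restrict_of_subset hsub hp)

theorem inner_ballIndicator_ballIndicator [NeZero N] {s : ℝ} (hr : 0 ≤ r) (hrs : r ≤ s)
    (hs : s ≤ R) :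
    inner ℝ (ballIndicator N R r) (ballIndicator N R s) = unitBallVolume N * r ^ N := by
  rw [inner_ballIndicator_of_ae (hrs.trans hs) (coeFn_ballIndicator R s), ← volume_real_ball hr,
    setIntegral_congr_fun (g := fun _ => 1) measurableSet_ball]
  · simp
  · exact fun x hx => if_pos ((mem_ball_zero_iff.1 hx).trans_le hrs)

theorem abs_inner_ballIndicator_le [NeZero N] (hr : 0 < r) (hrR : r ≤ R) :
    ∀ p ∈ dualBall (Metric.ball (0 : Euc N) R),
      |inner ℝ (ballIndicator N R r) p| ≤ perimeter N r := by
  refine forall_mem_dualBall_of_isClosed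
    (P := fun p => |inner ℝ (ballIndicator N R r) p| ≤ perimeter N r)
    (isClosed_le (continuous_const.inner continuous_id).abs continuous_const)
    fun φ hφ p hp => ?_
  rw [inner_ballIndicator_of_ae hrR hp]
  exact abs_setIntegral_ball_divergence_le hφ.smooth hφ.compactSupport hφ.norm_le hr

theorem inner_ballIndicator_self_eq_zero :
    ∀ p ∈ dualBall (Metric.ball (0 : Euc N) R), inner ℝ (ballIndicator N R R) p = 0 := by
  refine forall_mem_dualBall_of_isClosed
    (P := fun p => inner ℝ (ballIndicator N R R) p = 0)
    (isClosed_eq (continuous_const.inner continuous_id) continuous_const) fun φ hφ p hp => ?_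
  rw [inner_ballIndicator_of_ae le_rfl hp, setIntegral_eq_integral_of_forall_compl_eq_zero,
    integral_divergence (hφ.smooth.of_le (by simp)) hφ.compactSupport]
  intro x hx
  simp [divergence, fderiv_of_notMem_tsupport ℝ fun h => hx (hφ.support_subset h)]

end BallIndicator

section SmoothDense

theorem mem_closure_of_inner_eq_zero {H : Type*} [NormedAddCommGroup H] [InnerProductSpace ℝ H]
    {S : Submodule ℝ H} {e w : H} (hw : w ∈ closure (S : Set H)) (hew : inner ℝ e w = 0) :
    w ∈ closure {s | s ∈ S ∧ inner ℝ e s = 0} := by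
  by_cases hS : ∀ s ∈ S, inner ℝ e s = 0
  · refine closure_mono (fun s hs => ?_) hw
    exact ⟨hs, hS s hs⟩
  push Not at hS
  obtain ⟨s₀, hs₀, hes₀⟩ := hS
  have hcont : Continuous fun s => s - (inner ℝ e s / inner ℝ e s₀) • s₀ := by fun_prop
  have hmaps : Set.MapsTo (fun s => s - (inner ℝ e s / inner ℝ e s₀) • s₀) (S : Set H)
      {s | s ∈ S ∧ inner ℝ e s = 0} := fun s hs =>
    ⟨S.sub_mem hs (S.smul_mem _ hs₀), by
      rw [inner_sub_right, inner_smul_right, div_mul_cancel₀ _ hes₀, sub_self]⟩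
  simpa [hew] using map_mem_closure hcont hw hmaps

variable {E : Type*} [NormedAddCommGroup E] [NormedSpace ℝ E] [MeasurableSpace E]

/-- The classes in `L²(U, μ)` of the smooth functions with compact support in `U`. -/
def smoothClasses (μ : Measure E) (U : Set E) : Submodule ℝ (Lp ℝ 2 (μ.restrict U)) where
  carrier := {f | ∃ ψ : E → ℝ, ContDiff ℝ ∞ ψ ∧ HasCompactSupport ψ ∧ tsupport ψ ⊆ U ∧
    f =ᵐ[μ.restrict U] ψ}
  zero_mem' := ⟨0, contDiff_const, .zero, by simp [tsupport_zero], Lp.coeFn_zero _ _ _⟩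
  add_mem' := by
    rintro f g ⟨ψ, hψ, hψc, hψU, hfψ⟩ ⟨χ, hχ, hχc, hχU, hgχ⟩
    exact ⟨ψ + χ, hψ.add hχ, hψc.add hχc,
      (tsupport_add ψ χ).trans (Set.union_subset hψU hχU),
      (Lp.coeFn_add f g).trans (hfψ.add hgχ)⟩
  smul_mem' := by
    rintro c f ⟨ψ, hψ, hψc, hψU, hfψ⟩
    exact ⟨c • ψ, hψ.const_smul c, hψc.smul_left (f := fun _ => c),
      (tsupport_smul_subset_right (fun _ => c) ψ).trans hψU,
      (Lp.coeFn_smul c f).trans (hfψ.const_smul c)⟩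

theorem dense_smoothClasses [FiniteDimensional ℝ E] [BorelSpace E] (μ : Measure E)
    [IsLocallyFiniteMeasure μ] {U : Set E} (hU : IsOpen U) :
    Dense (smoothClasses μ U : Set (Lp ℝ 2 (μ.restrict U))) := by
  rw [Submodule.dense_iff_topologicalClosure_eq_top, Submodule.topologicalClosure_eq_top_iff,
    Submodule.eq_bot_iff]
  intro f hf
  have hloc : LocallyIntegrableOn f U μ :=
    locallyIntegrableOn_of_locallyIntegrable_restrict
      ((Lp.memLp f).locallyIntegrable one_le_two)
  have hzero := hU.ae_eq_zero_of_integral_contDiff_smul_eq_zero hloc fun ψ hψ hψc hψU => by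
    have hmem : MemLp ψ 2 (μ.restrict U) := hψ.continuous.memLp_of_hasCompactSupport hψc
    have horth := (Submodule.mem_orthogonal _ _).1 hf hmem.toLp
      ⟨ψ, hψ, hψc, hψU, hmem.coeFn_toLp⟩
    rw [L2.inner_def] at horth
    rw [← setIntegral_eq_integral_of_forall_compl_eq_zero (s := U) fun x hx => by
      rw [image_eq_zero_of_notMem_tsupport fun h => hx (hψU h), zero_smul], ← horth]
    refine integral_congr_ae ?_
    filter_upwards [hmem.coeFn_toLp] with x hx
    simp [hx, mul_comm]
  refine Lp.ext ?_
  filter_upwards [(ae_restrict_iff' hU.measurableSet).2 hzero, Lp.coeFn_zero ℝ 2 (μ.restrict U)]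
    with x hx h0
  rw [hx, h0, Pi.zero_apply]

end SmoothDense

section RadialLift

instance isFiniteMeasure_restrict_ball (x : Euc N) (R : ℝ) :
    IsFiniteMeasure (volume.restrict (Metric.ball x R)) :=
  isFiniteMeasure_restrict.2 measure_ball_lt_top.ne

variable [NeZero N]

theorem map_norm_restrict_ball_le {R : ℝ} (hR : 0 ≤ R) :
    (volume.restrict (Metric.ball (0 : Euc N) R)).map norm ≤
      ENNReal.ofReal (perimeter N R) • volume.restrict (Set.Ioo 0 R) := by
  refine Measure.le_iff.2 fun s hs => ?_
  have hω := unitBallVolume_pos N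
  have hpre : MeasurableSet ((norm : Euc N → ℝ) ⁻¹' s) := measurable_norm hs
  have hint : Integrable (s.indicator (1 : ℝ → ℝ)) (volume.restrict (Set.Ioo 0 R)) :=
    (integrable_const 1).indicator hs
  have hpolar : (volume.restrict (Metric.ball (0 : Euc N) R)).real (norm ⁻¹' s) ≤
      perimeter N R * (volume.restrict (Set.Ioo 0 R)).real s := calc
    _ = ∫ x in Metric.ball (0 : Euc N) R, s.indicator 1 ‖x‖ := by
      rw [← integral_indicator_one hpre]
      rfl
    _ = N * unitBallVolume N * ∫ t in Set.Ioo 0 R, t ^ (N - 1) * s.indicator 1 t := by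
      rw [setIntegral_ball_comp_norm _ hR, intervalIntegral.integral_of_le hR,
        integral_Ioc_eq_integral_Ioo]
    _ ≤ N * unitBallVolume N * ∫ t in Set.Ioo 0 R, R ^ (N - 1) * s.indicator 1 t := by
      refine mul_le_mul_of_nonneg_left ?_ (by positivity)
      refine integral_mono_of_nonneg ?_ (hint.const_mul _) ?_ <;>
        filter_upwards [ae_restrict_mem measurableSet_Ioo] with t ht
      · exact mul_nonneg (pow_nonneg ht.1.le _) (Set.indicator_nonneg (by simp) t)
      · have h0 := ht.1.le
        have h1 : 0 ≤ s.indicator (1 : ℝ → ℝ) t := Set.indicator_nonneg (by simp) t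
        gcongr
        exact ht.2.le
    _ = perimeter N R * (volume.restrict (Set.Ioo 0 R)).real s := by
      rw [integral_const_mul, integral_indicator_one hs, perimeter, mul_assoc _ (R ^ _)]
  rw [Measure.map_apply measurable_norm hs, Measure.smul_apply, smul_eq_mul,
    ← ofReal_measureReal, ← ofReal_measureReal (μ := volume.restrict (Set.Ioo 0 R)),
    ← ENNReal.ofReal_mul (by unfold perimeter; positivity)]
  exact ENNReal.ofReal_le_ofReal hpolar

/-- The map sending the class of `w` in `L²(0, R)` to the class of `x ↦ w ‖x‖` in
`L²(B(0, R))`. -/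
noncomputable def radialLift (N : ℕ) [NeZero N] {R : ℝ} (hR : 0 ≤ R) :
    Lp ℝ 2 (volume.restrict (Set.Ioo 0 R)) →L[ℝ] L2 (Metric.ball (0 : Euc N) R) :=
  (Lp.compMeasurePreservingₗᵢ ℝ norm ⟨measurable_norm, rfl⟩).toContinuousLinearMap ∘L
    Lp.LpToLpOfMeasureLeSMul ENNReal.ofReal_ne_top (map_norm_restrict_ball_le hR)

theorem coeFn_radialLift {R : ℝ} (hR : 0 ≤ R) {f : Lp ℝ 2 (volume.restrict (Set.Ioo 0 R))}
    {w : ℝ → ℝ} (hf : f =ᵐ[volume.restrict (Set.Ioo 0 R)] w) :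
    radialLift N hR f =ᵐ[volume.restrict (Metric.ball 0 R)] fun x => w ‖x‖ := by
  have hle := map_norm_restrict_ball_le (N := N) hR
  have hpres : MeasurePreserving norm (volume.restrict (Metric.ball (0 : Euc N) R)) _ :=
    ⟨measurable_norm, rfl⟩
  refine (Lp.coeFn_compMeasurePreserving _ hpres).trans ?_
  exact hpres.quasiMeasurePreserving.ae_eq_comp ((Lp.coeFn_LpToLpOfMeasureLeSMul _ hle f).trans
    ((Measure.absolutelyContinuous_of_le_smul hle).ae_eq hf))

end RadialLift

section RadialField

/-- The integral of the radial function `x ↦ w ‖x‖` over the ball of radius `r`, divided by the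
perimeter of the unit ball. A radial field with divergence `w ‖x‖` has outward speed
`flux N w r / r ^ (N - 1)` on the sphere of radius `r`. -/
noncomputable def flux (N : ℕ) (w : ℝ → ℝ) (r : ℝ) : ℝ :=
  ∫ t in 0..r, t ^ (N - 1) * w t

/-- The vector field whose value at `x` is `f ‖x‖` times the position vector `x`. -/
noncomputable def radialField (f : ℝ → ℝ) (x : Euc N) : Euc N :=
  f ‖x‖ • x

variable {f w : ℝ → ℝ} {r R δ : ℝ}

theorem hasDerivAt_flux (hw : Continuous w) (r : ℝ) :
    HasDerivAt (flux N w) (r ^ (N - 1) * w r) r :=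
  (by fun_prop : Continuous fun t => t ^ (N - 1) * w t).integral_hasStrictDerivAt 0 r
    |>.hasDerivAt

theorem contDiff_flux (hw : ContDiff ℝ ∞ w) : ContDiff ℝ ∞ (flux N w) := by
  have hderiv := hasDerivAt_flux (N := N) hw.continuous
  rw [contDiff_infty_iff_deriv, funext fun r => (hderiv r).deriv]
  exact ⟨fun r => (hderiv r).differentiableAt, by fun_prop⟩

theorem flux_eq_zero_of_le (hδ : 0 ≤ δ) (hw : ∀ t ≤ δ, w t = 0) (hr : r ≤ δ) :
    flux N w r = 0 := by
  refine (intervalIntegral.integral_congr fun t ht => ?_).trans intervalIntegral.integral_zero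
  rw [hw t (ht.2.trans (max_le hδ hr)), mul_zero]

theorem flux_eq_zero_of_ge (hw : Continuous w) (hR : flux N w R = 0) (hδR : δ ≤ R)
    (hwδ : ∀ t, δ ≤ t → w t = 0) (hr : δ ≤ r) : flux N w r = 0 := by
  have hint (a b : ℝ) : IntervalIntegrable (fun t => t ^ (N - 1) * w t) volume a b :=
    Continuous.intervalIntegrable (by fun_prop) a b
  calc flux N w r = flux N w r - flux N w R := by rw [hR, sub_zero]
    _ = ∫ t in R..r, t ^ (N - 1) * w t :=
      intervalIntegral.integral_interval_sub_left (hint 0 r) (hint 0 R)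
    _ = ∫ _ in R..r, 0 := intervalIntegral.integral_congr fun t ht => by
      rw [hwδ t ((le_min hδR hr).trans ht.1), mul_zero]
    _ = 0 := intervalIntegral.integral_zero

theorem contDiff_radialField (hf : ContDiff ℝ ∞ f) (hδ : 0 < δ) (hfδ : ∀ t ≤ δ, f t = 0) :
    ContDiff ℝ ∞ (radialField (N := N) f) := by
  refine contDiff_iff_contDiffAt.2 fun x => ?_
  rcases eq_or_ne x 0 with rfl | hx
  · refine (contDiffAt_const (c := 0)).congr_of_eventuallyEq ?_
    filter_upwards [Metric.ball_mem_nhds (0 : Euc N) hδ] with y hy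
    rw [radialField, hfδ _ (mem_ball_zero_iff.1 hy).le, zero_smul]
  · exact (hf.contDiffAt.comp x (contDiffAt_norm ℝ hx)).smul contDiffAt_id

theorem divergence_radialField {f' : ℝ} {x : Euc N} (hx : x ≠ 0) (hf : HasDerivAt f f' ‖x‖) :
    divergence (radialField f) x = N * f ‖x‖ + ‖x‖ * f' := by
  have hnorm := (contDiffAt_norm ℝ hx (n := 1)).differentiableAt one_ne_zero
  have hfield := ((hf.comp_hasFDerivAt x hnorm.hasFDerivAt).smul (hasFDerivAt_id x)).fderiv
  change fderiv ℝ (radialField f) x = _ at hfield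
  have hcoord (i : Fin N) : fderiv ℝ (radialField f) x (EuclideanSpace.single i 1) i =
      f ‖x‖ + f' * (fderiv ℝ norm x (EuclideanSpace.single i 1) * x i) := by
    rw [hfield]
    simp
    ring
  simp only [divergence, hcoord, Finset.sum_add_distrib, ← Finset.mul_sum, sum_apply_single_mul,
    hnorm.fderiv_norm_self, Finset.sum_const, Finset.card_univ, Fintype.card_fin, nsmul_eq_mul]
  ring

theorem isTestField_radialField (hf : ContDiff ℝ ∞ f) (hδ : 0 < δ) (hfδ : ∀ t ≤ δ, f t = 0)
    (hr : r < R) (hfr : ∀ t, r ≤ t → f t = 0) (hbound : ∀ t ∈ Set.Ioo 0 R, |t * f t| ≤ 1) :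
    IsTestField (Metric.ball (0 : Euc N) R) (radialField f) := by
  have hsupp : Function.support (radialField (N := N) f) ⊆ Metric.closedBall 0 r := fun x hx => by
    contrapose! hx
    rw [mem_closedBall_zero_iff, not_le] at hx
    rw [Function.mem_support, not_not, radialField, hfr _ hx.le, zero_smul]
  refine ⟨contDiff_radialField hf hδ hfδ,
    .of_support_subset_isCompact (isCompact_closedBall 0 r) hsupp,
    (closure_minimal hsupp Metric.isClosed_closedBall).trans (Metric.closedBall_subset_ball hr),
    fun x hx => ?_⟩
  rcases eq_or_ne x 0 with rfl | hx0
  · simp [radialField]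
  · simpa [radialField, norm_smul, mul_comm] using
      hbound ‖x‖ ⟨norm_pos_iff.2 hx0, mem_ball_zero_iff.1 hx⟩

theorem exists_margin_of_tsupport_subset_Ioo (hc : HasCompactSupport w)
    (hw : tsupport w ⊆ Set.Ioo 0 R) :
    ∃ δ > 0, (∀ t ≤ δ, w t = 0) ∧ ∀ t, R - δ ≤ t → w t = 0 := by
  obtain ⟨δ, hδ, hthick⟩ := hc.isCompact.exists_cthickening_subset_open isOpen_Ioo hw
  have hmem {t s : ℝ} (ht : t ∈ tsupport w) (hts : |s - t| ≤ δ) : s ∈ Set.Ioo 0 R :=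
    hthick (Metric.mem_cthickening_of_dist_le s t δ _ ht hts)
  refine ⟨δ, hδ, fun t ht => ?_, fun t ht => ?_⟩ <;>
    refine image_eq_zero_of_notMem_tsupport fun hts => ?_
  · have hpos := (hw hts).1
    exact lt_irrefl _ (hmem hts (s := 0) (by rwa [zero_sub, abs_neg, abs_of_pos hpos])).1
  · have hlt := (hw hts).2
    exact lt_irrefl _ (hmem hts (s := R) (by rw [abs_of_pos (by linarith)]; linarith)).2

theorem contDiff_flux_div_pow (hw : ContDiff ℝ ∞ w) (hδ : 0 < δ) (hwδ : ∀ t ≤ δ, w t = 0) :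
    ContDiff ℝ ∞ fun t => flux N w t / t ^ N := by
  refine contDiff_iff_contDiffAt.2 fun t => ?_
  rcases lt_or_ge t δ with ht | ht
  · refine (contDiffAt_const (c := 0)).congr_of_eventuallyEq ?_
    filter_upwards [Iio_mem_nhds ht] with s hs
    rw [flux_eq_zero_of_le hδ.le hwδ hs.le, zero_div]
  · exact (contDiff_flux hw).contDiffAt.div (contDiff_id.pow N).contDiffAt
      (pow_pos (hδ.trans_le ht) N).ne'

variable [NeZero N]

theorem divergence_radialField_flux (hw : Continuous w) {x : Euc N} (hx : x ≠ 0) :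
    divergence (radialField fun t => flux N w t / t ^ N) x = w ‖x‖ := by
  have hnorm := norm_pos_iff.2 hx
  obtain ⟨n, rfl⟩ := Nat.exists_eq_succ_of_ne_zero (NeZero.ne N)
  rw [divergence_radialField hx ((hasDerivAt_flux hw ‖x‖).fun_div (hasDerivAt_pow _ _)
    (pow_pos hnorm _).ne')]
  simp only [Nat.succ_eq_add_one, add_tsub_cancel_right]
  field_simp
  ring

theorem mem_divergences_of_abs_flux_le (hw : ContDiff ℝ ∞ w) (hc : HasCompactSupport w)
    (hsupp : tsupport w ⊆ Set.Ioo 0 R) (hR : flux N w R = 0)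
    (hbound : ∀ t ∈ Set.Ioo 0 R, |flux N w t| ≤ t ^ (N - 1)) {p : L2 (Metric.ball (0 : Euc N) R)}
    (hp : p =ᵐ[volume.restrict (Metric.ball 0 R)] fun x => w ‖x‖) :
    p ∈ divergences (Metric.ball (0 : Euc N) R) := by
  obtain ⟨δ, hδ, hlow, hhigh⟩ := exists_margin_of_tsupport_subset_Ioo hc hsupp
  refine ⟨radialField fun t => flux N w t / t ^ N, ?_, hp.trans ?_⟩
  · refine isTestField_radialField (r := R - δ) (contDiff_flux_div_pow hw hδ hlow) hδ
      (fun t ht => ?_) (by linarith) (fun t ht => ?_) fun t ht => ?_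
    · rw [flux_eq_zero_of_le hδ.le hlow ht, zero_div]
    · rw [flux_eq_zero_of_ge hw.continuous hR (by linarith) hhigh ht, zero_div]
    · have hpow : 0 < t ^ (N - 1) := pow_pos ht.1 _
      rw [← pow_sub_one_mul (NeZero.ne N) t, mul_div_assoc', mul_comm t,
        mul_div_mul_right _ _ ht.1.ne', abs_div, abs_of_pos hpow, div_le_one hpow]
      exact hbound t ht
  · filter_upwards [ae_restrict_of_ae (compl_mem_ae_iff.2 (measure_singleton (0 : Euc N)))]
      with x hx
    exact (divergence_radialField_flux hw.continuous hx).symm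

end RadialField

section RadialDualBall

variable {r R : ℝ}

theorem memLp_indicator_pow (n : ℕ) (r R : ℝ) :
    MemLp ((Set.Iio r).indicator fun t => t ^ n) 2 (volume.restrict (Set.Ioo 0 R)) := by
  refine .of_bound ((by fun_prop : Measurable fun t : ℝ => t ^ n).indicator
    measurableSet_Iio).aestronglyMeasurable (R ^ n) ?_
  filter_upwards [ae_restrict_mem measurableSet_Ioo] with t ht
  refine (norm_indicator_le_norm_self _ _).trans ?_
  rw [Real.norm_of_nonneg (pow_nonneg ht.1.le _)]
  exact pow_le_pow_left₀ ht.1.le ht.2.le _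

/-- The element of `L²(0, R)` representing the functional `w ↦ flux N w r`. -/
noncomputable def fluxKernel (N : ℕ) (R r : ℝ) : Lp ℝ 2 (volume.restrict (Set.Ioo 0 R)) :=
  (memLp_indicator_pow (N - 1) r R).toLp

theorem inner_fluxKernel_of_ae {f : Lp ℝ 2 (volume.restrict (Set.Ioo 0 R))} {w : ℝ → ℝ}
    (hf : f =ᵐ[volume.restrict (Set.Ioo 0 R)] w) (hr : 0 ≤ r) (hrR : r ≤ R) :
    inner ℝ (fluxKernel N R r) f = flux N w r := by
  have hset : Set.Ioo 0 R ∩ Set.Iio r = Set.Ioo 0 r := by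
    rw [Set.Ioo_inter_Iio, min_eq_right hrR]
  rw [flux, intervalIntegral.integral_of_le hr, integral_Ioc_eq_integral_Ioo, ← hset,
    ← setIntegral_indicator measurableSet_Iio, L2.inner_def]
  refine integral_congr_ae ?_
  filter_upwards [hf, (memLp_indicator_pow (N - 1) r R).coeFn_toLp] with t hft hkernel
  rw [hft, fluxKernel, hkernel]
  by_cases ht : t ∈ Set.Iio r <;> simp [ht, mul_comm]

theorem norm_fluxKernel_le (hr : 0 ≤ r) (hR : 0 ≤ R) :
    ‖fluxKernel N R r‖ ≤ √R * r ^ (N - 1) := by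
  have hbound : ∀ᵐ t ∂volume.restrict (Set.Ioo 0 R),
      ‖fluxKernel N R r t‖ ≤ r ^ (N - 1) := by
    filter_upwards [(memLp_indicator_pow (N - 1) r R).coeFn_toLp,
      ae_restrict_mem measurableSet_Ioo] with t hkernel ht
    rw [fluxKernel, hkernel]
    by_cases htr : t ∈ Set.Iio r
    · rw [Set.indicator_of_mem htr, Real.norm_of_nonneg (pow_nonneg ht.1.le _)]
      exact pow_le_pow_left₀ ht.1.le (le_of_lt htr) _
    · rw [Set.indicator_of_notMem htr, norm_zero]
      exact pow_nonneg hr _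
  refine (Lp.norm_le_of_ae_bound (pow_nonneg hr _) hbound).trans_eq ?_
  congr 1
  have hvol : (measureUnivNNReal (volume.restrict (Set.Ioo 0 R)) : ℝ) = R := by
    simp [measureUnivNNReal, ENNReal.ofReal, hR]
  simp [hvol, Real.sqrt_eq_rpow]

variable [NeZero N]

theorem inner_ballIndicator_eq_flux {p : L2 (Metric.ball (0 : Euc N) R)} {w : ℝ → ℝ}
    (hp : p =ᵐ[volume.restrict (Metric.ball 0 R)] fun x => w ‖x‖) (hr : 0 ≤ r) (hrR : r ≤ R) :
    inner ℝ (ballIndicator N R r) p = N * unitBallVolume N * flux N w r := by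
  rw [inner_ballIndicator_of_ae hrR hp, setIntegral_ball_comp_norm w hr, flux]

theorem smul_radialLift_mem_divergences (hR : 0 < R)
    {f s : Lp ℝ 2 (volume.restrict (Set.Ioo 0 R))}
    (hf : ∀ r ∈ Set.Ioo 0 R, |inner ℝ (fluxKernel N R r) f| ≤ r ^ (N - 1))
    (hs : s ∈ smoothClasses volume (Set.Ioo 0 R)) (hsR : inner ℝ (fluxKernel N R R) s = 0) :
    (1 + √R * ‖s - f‖)⁻¹ • radialLift N hR.le s ∈ divergences (Metric.ball (0 : Euc N) R) := by
  set c := 1 + √R * ‖s - f‖ with hc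
  have hc0 : 0 < c := by positivity
  obtain ⟨ψ, hψ, hψc, hψR, hcψ⟩ := (smoothClasses volume (Set.Ioo 0 R)).smul_mem c⁻¹ hs
  rw [← map_smul]
  refine mem_divergences_of_abs_flux_le hψ hψc hψR ?_ (fun r hr => ?_)
    (coeFn_radialLift hR.le hcψ)
  · rw [← inner_fluxKernel_of_ae hcψ hR.le le_rfl, inner_smul_right, hsR, mul_zero]
  · have hdiff : |inner ℝ (fluxKernel N R r) (s - f)| ≤ √R * r ^ (N - 1) * ‖s - f‖ :=
      (abs_real_inner_le_norm _ _).trans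
        (mul_le_mul_of_nonneg_right (norm_fluxKernel_le hr.1.le hR.le) (norm_nonneg _))
    rw [← inner_fluxKernel_of_ae hcψ hr.1.le hr.2.le, inner_smul_right, abs_mul, abs_inv,
      abs_of_pos hc0, inv_mul_le_iff₀ hc0]
    calc |inner ℝ (fluxKernel N R r) s|
        = |inner ℝ (fluxKernel N R r) f + inner ℝ (fluxKernel N R r) (s - f)| := by
          rw [← inner_add_right, add_sub_cancel]
      _ ≤ r ^ (N - 1) + √R * r ^ (N - 1) * ‖s - f‖ :=
          (abs_add_le _ _).trans (add_le_add (hf r hr) hdiff)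
      _ = c * r ^ (N - 1) := by rw [hc]; ring

/-- Mollify the profile in the radial variable: the approximants satisfy the flux bounds only up to
a factor tending to `1`, by which one divides. -/
theorem mem_dualBall_of_abs_inner_ballIndicator_le (hR : 0 < R)
    {p : L2 (Metric.ball (0 : Euc N) R)} {w : ℝ → ℝ}
    (hw : MemLp w 2 (volume.restrict (Set.Ioo 0 R)))
    (hp : p =ᵐ[volume.restrict (Metric.ball 0 R)] fun x => w ‖x‖)
    (hbound : ∀ r ∈ Set.Ioo 0 R, |inner ℝ (ballIndicator N R r) p| ≤ perimeter N r)
    (hlast : inner ℝ (ballIndicator N R R) p = 0) :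
    p ∈ dualBall (Metric.ball (0 : Euc N) R) := by
  have hω := unitBallVolume_pos N
  have hN : (0 : ℝ) < N := Nat.cast_pos.2 (NeZero.pos N)
  set f := hw.toLp
  have hpf : radialLift N hR.le f = p :=
    Lp.ext ((coeFn_radialLift hR.le hw.coeFn_toLp).trans hp.symm)
  have hinner {r : ℝ} (hr : 0 ≤ r) (hrR : r ≤ R) : inner ℝ (ballIndicator N R r) p =
      N * unitBallVolume N * inner ℝ (fluxKernel N R r) f := by
    rw [inner_ballIndicator_eq_flux hp hr hrR, inner_fluxKernel_of_ae hw.coeFn_toLp hr hrR]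
  have hf (r : ℝ) (hr : r ∈ Set.Ioo 0 R) : |inner ℝ (fluxKernel N R r) f| ≤ r ^ (N - 1) := by
    have h := hbound r hr
    rw [hinner hr.1.le hr.2.le, abs_mul, abs_of_pos (by positivity), perimeter] at h
    exact le_of_mul_le_mul_left h (by positivity)
  have hfR : inner ℝ (fluxKernel N R R) f = 0 := by
    simpa [hinner hR.le le_rfl, hω.ne', NeZero.ne] using hlast
  have hcont : Continuous fun s => (1 + √R * ‖s - f‖)⁻¹ • radialLift N hR.le s :=
    ((by fun_prop : Continuous fun s => 1 + √R * ‖s - f‖).inv₀ fun s => by positivity).smul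
      (radialLift N hR.le).continuous
  have hclosure := map_mem_closure hcont
    (mem_closure_of_inner_eq_zero (dense_smoothClasses volume isOpen_Ioo f) hfR)
    fun s hs => smul_radialLift_mem_divergences hR hf hs.1 hs.2
  simpa [hpf, dualBall] using hclosure

end RadialDualBall

section RadialSteps

variable {R : ℝ}

theorem IsRadial.exists_measurable [NeZero N] {g : L2 (Metric.ball (0 : Euc N) R)}
    (hg : IsRadial (Metric.ball 0 R) g) :
    ∃ γ : ℝ → ℝ, Measurable γ ∧ g =ᵐ[volume.restrict (Metric.ball 0 R)] fun x => γ ‖x‖ := by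
  obtain ⟨γ, hγ⟩ := hg
  rw [ae_restrict_iff' measurableSet_ball] at hγ
  have hpolar := (volume : Measure (Euc N)).measurePreserving_homeomorphUnitSphereProd
  have hpolar_symm := hpolar.symm (homeomorphUnitSphereProd (Euc N)).toMeasurableEquiv
  have hsub : ∀ᵐ x : ({0}ᶜ : Set (Euc N)) ∂(volume.comap Subtype.val),
      (x : Euc N) ∈ Metric.ball 0 R → g x = γ ‖(x : Euc N)‖ :=
    (ae_restrict_iff_subtype (measurableSet_singleton _).compl).1 (ae_restrict_of_ae hγ)
  have : (ae (volume : Measure (Euc N)).toSphere).NeBot :=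
    ae_neBot.2 (Measure.toSphere_ne_zero _)
  obtain ⟨θ, hθ⟩ :=
    (Measure.ae_ae_of_ae_prod (hpolar_symm.quasiMeasurePreserving.ae hsub)).exists
  have hθnorm : ‖(θ : Euc N)‖ = 1 := mem_sphere_zero_iff_norm.1 θ.2
  refine ⟨fun ρ => g (ρ • (θ : Euc N)),
    (Lp.stronglyMeasurable g).measurable.comp (by fun_prop), ?_⟩
  have hray := (ae_restrict_iff_subtype (μ := (volume : Measure (Euc N)))
    (measurableSet_singleton (0 : Euc N)).compl
    (p := fun x => ‖x‖ < R → g (‖x‖ • (θ : Euc N)) = γ ‖x‖)).2 (by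
      filter_upwards [(Measure.quasiMeasurePreserving_snd.comp
        hpolar.quasiMeasurePreserving).ae hθ] with x hx hxR
      simpa [norm_smul, hθnorm, hxR] using hx)
  rw [restrict_compl_singleton] at hray
  rw [Filter.EventuallyEq, ae_restrict_iff' measurableSet_ball]
  filter_upwards [hray, hγ] with x hxray hxγ hx
  rw [hxγ hx, hxray (mem_ball_zero_iff.1 hx)]

/-- The indicator functions of the balls whose radii divide `[0, R]` into `n` equal parts. -/
noncomputable def uniformChain (N : ℕ) (R : ℝ) (n k : ℕ) : L2 (Metric.ball (0 : Euc N) R) :=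
  ballIndicator N R (k * R / n)

theorem lt_mul_div_iff_floor_lt {n k : ℕ} {t : ℝ} (hR : 0 < R) (hn : 0 < n) (ht : 0 ≤ t) :
    t < k * R / n ↔ ⌊n * t / R⌋₊ < k := by
  rw [Nat.floor_lt (by positivity), lt_div_iff₀ (by positivity), div_lt_iff₀ hR, mul_comm]

theorem floor_mul_div_lt {n : ℕ} {t : ℝ} (hn : 0 < n) (ht : 0 ≤ t) (htR : t < R) :
    ⌊n * t / R⌋₊ < n := by
  rwa [← lt_mul_div_iff_floor_lt (ht.trans_lt htR) hn ht, mul_div_cancel_left₀ _ (by positivity)]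

theorem mem_Ico_floor_mul_div {n : ℕ} {t : ℝ} (hR : 0 < R) (hn : 0 < n) (ht : 0 ≤ t) :
    t ∈ Set.Ico (⌊n * t / R⌋₊ * R / n) ((⌊n * t / R⌋₊ + 1 : ℕ) * R / n) :=
  ⟨not_lt.1 fun h => lt_irrefl _ ((lt_mul_div_iff_floor_lt hR hn ht).1 h),
    (lt_mul_div_iff_floor_lt hR hn ht).2 (Nat.lt_succ_self _)⟩

theorem coeFn_stepSum_uniformChain (hR : 0 < R) {n : ℕ} (hn : 0 < n) (a : ℕ → ℝ) :
    ⇑(stepSum n (uniformChain N R n) a) =ᵐ[volume.restrict (Metric.ball 0 R)]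
      fun x => a ⌊n * ‖x‖ / R⌋₊ := by
  have hincrement : ∀ᵐ x ∂volume.restrict (Metric.ball (0 : Euc N) R), ∀ k : ℕ,
      (a k • (uniformChain N R n (k + 1) - uniformChain N R n k)) x =
        a k * ((if ‖x‖ < (k + 1 : ℕ) * R / n then 1 else 0) -
          (if ‖x‖ < k * R / n then 1 else 0)) := by
    refine ae_all_iff.2 fun k => ?_
    filter_upwards [Lp.coeFn_smul (a k) (uniformChain N R n (k + 1) - uniformChain N R n k),
      Lp.coeFn_sub (uniformChain N R n (k + 1)) (uniformChain N R n k),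
      coeFn_ballIndicator (N := N) R ((k + 1 : ℕ) * R / n),
      coeFn_ballIndicator (N := N) R (k * R / n)] with x hsmul hsub hsucc hk
    rw [hsmul, Pi.smul_apply, hsub, Pi.sub_apply, uniformChain, uniformChain, hsucc, hk,
      smul_eq_mul]
  filter_upwards [hincrement, Lp.coeFn_finsetSum (Finset.range n)
    fun k => a k • (uniformChain N R n (k + 1) - uniformChain N R n k),
    ae_restrict_mem measurableSet_ball] with x hx hsum hxR
  rw [mem_ball_zero_iff] at hxR
  rw [stepSum, hsum, Finset.sum_apply]
  simp only [hx, lt_mul_div_iff_floor_lt hR hn (norm_nonneg x)]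
  rw [Finset.sum_eq_single_of_mem _ (Finset.mem_range.2 (floor_mul_div_lt hn (norm_nonneg x) hxR))]
  · simp
  · intro k _ hk
    rcases lt_or_gt_of_ne hk with hlt | hlt
    · rw [if_neg (by omega), if_neg (by omega), sub_self, mul_zero]
    · rw [if_pos (by omega), if_pos (by omega), sub_self, mul_zero]

/-- The radial step functions on `B(0, R)` whose shells have equal width. -/
def radialSteps (N : ℕ) (R : ℝ) : Set (L2 (Metric.ball (0 : Euc N) R)) :=
  {v | ∃ n, 0 < n ∧ ∃ a, v = stepSum n (uniformChain N R n) a}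

theorem mem_closure_radialSteps_of_uniformContinuous (hR : 0 < R) {h : ℝ → ℝ}
    (hh : UniformContinuous h) {v : L2 (Metric.ball (0 : Euc N) R)}
    (hv : v =ᵐ[volume.restrict (Metric.ball 0 R)] fun x => h ‖x‖) :
    v ∈ closure (radialSteps N R) := by
  set c := (measureUnivNNReal (volume.restrict (Metric.ball (0 : Euc N) R)) : ℝ) ^
    (2 : ℝ≥0∞).toReal⁻¹
  refine Metric.mem_closure_iff.2 fun ε hε => ?_
  obtain ⟨δ, hδ, hhδ⟩ := Metric.uniformContinuous_iff.1 hh (ε / (c + 1)) (by positivity)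
  obtain ⟨n, hn⟩ := exists_nat_gt (R / δ)
  have hn0 : 0 < n := Nat.cast_pos.1 ((div_pos hR hδ).trans hn)
  have hwidth : R / n < δ := (div_lt_comm₀ (by positivity) hδ).2 hn
  refine ⟨stepSum n (uniformChain N R n) fun k => h (k * R / n), ⟨n, hn0, _, rfl⟩, ?_⟩
  have hbound : ∀ᵐ x ∂volume.restrict (Metric.ball (0 : Euc N) R),
      ‖(v - stepSum n (uniformChain N R n) fun k => h (k * R / n)) x‖ ≤ ε / (c + 1) := by
    filter_upwards [hv, coeFn_stepSum_uniformChain hR hn0 fun k => h (k * R / n),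
      Lp.coeFn_sub v (stepSum n (uniformChain N R n) fun k => h (k * R / n))] with x hxv hx hsub
    rw [hsub, Pi.sub_apply, hxv, hx, ← dist_eq_norm]
    obtain ⟨hle, hlt⟩ := mem_Ico_floor_mul_div hR hn0 (norm_nonneg x)
    refine (hhδ ?_).le
    rw [Real.dist_eq, abs_of_nonneg (sub_nonneg.2 hle)]
    push_cast at hlt
    rw [add_mul, one_mul, add_div] at hlt
    linarith
  rw [dist_eq_norm]
  calc _ ≤ c * (ε / (c + 1)) := Lp.norm_le_of_ae_bound (by positivity) hbound
    _ < ε := by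
      rw [mul_div_assoc', div_lt_iff₀ (by positivity)]
      linarith

theorem IsRadial.mem_closure_radialSteps [NeZero N] (hR : 0 < R)
    {g : L2 (Metric.ball (0 : Euc N) R)} (hg : IsRadial (Metric.ball 0 R) g) :
    g ∈ closure (radialSteps N R) := by
  obtain ⟨γ, hγ, hgγ⟩ := hg.exists_measurable
  have hpres : MeasurePreserving norm (volume.restrict (Metric.ball (0 : Euc N) R)) _ :=
    ⟨measurable_norm, rfl⟩
  have hmem : MemLp γ 2 ((volume.restrict (Metric.ball (0 : Euc N) R)).map norm) := by
    rw [memLp_map_measure_iff hγ.aestronglyMeasurable measurable_norm.aemeasurable]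
    exact (memLp_congr_ae hgγ).1 (Lp.memLp g)
  have hcomp {f : Lp ℝ 2 ((volume.restrict (Metric.ball (0 : Euc N) R)).map norm)} {w : ℝ → ℝ}
      (hf : f =ᵐ[(volume.restrict (Metric.ball (0 : Euc N) R)).map norm] w) :
      Lp.compMeasurePreservingₗᵢ ℝ norm hpres f =ᵐ[volume.restrict (Metric.ball 0 R)]
        fun x => w ‖x‖ :=
    (Lp.coeFn_compMeasurePreserving f hpres).trans (hpres.quasiMeasurePreserving.ae_eq_comp hf)
  have hg_eq : Lp.compMeasurePreservingₗᵢ ℝ norm hpres hmem.toLp = g :=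
    Lp.ext ((hcomp hmem.coeFn_toLp).trans hgγ.symm)
  rw [← hg_eq, ← closure_closure]
  refine map_mem_closure (Lp.compMeasurePreservingₗᵢ ℝ norm hpres).continuous
    (Lp.dense_hasCompactSupport_contDiff ENNReal.ofNat_ne_top hmem.toLp) ?_
  rintro f ⟨h, hfh, hhc, hh⟩
  exact mem_closure_radialSteps_of_uniformContinuous hR
    (hhc.uniformContinuous_of_continuous hh.continuous) (hcomp hfh)

end RadialSteps

section UniformChain

/-- The perimeter of a ball in dimension `N`, as a function of its volume `v`. -/
noncomputable def perimeterOfVolume (N : ℕ) (v : ℝ) : ℝ :=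
  N * unitBallVolume N * (v / unitBallVolume N) ^ (((N : ℝ) - 1) / N)

variable [NeZero N] {r s ρ R α β : ℝ}

theorem perimeterOfVolume_mul_pow (hr : 0 ≤ r) :
    perimeterOfVolume N (unitBallVolume N * r ^ N) = perimeter N r := by
  have hN : (N : ℝ) ≠ 0 := Nat.cast_ne_zero.2 (NeZero.ne N)
  rw [perimeterOfVolume, perimeter, mul_div_cancel_left₀ _ (unitBallVolume_pos N).ne',
    ← Real.rpow_natCast_mul hr, mul_div_cancel₀ _ hN, ← Nat.cast_pred (NeZero.pos N),
    Real.rpow_natCast]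

theorem concaveOn_perimeterOfVolume : ConcaveOn ℝ (Set.Ici 0) (perimeterOfVolume N) := by
  have hω := unitBallVolume_pos N
  have hN : (1 : ℝ) ≤ N := Nat.one_le_cast.2 NeZero.one_le
  have hrpow : ConcaveOn ℝ (Set.Ici 0) fun v : ℝ => v ^ (((N : ℝ) - 1) / N) :=
    Real.concaveOn_rpow (div_nonneg (by linarith) (by linarith))
      ((div_le_one (by linarith)).2 (by linarith))
  have hscaled := (hrpow.comp_linearMap (LinearMap.lsmul ℝ ℝ (unitBallVolume N)⁻¹)).subset
    (fun v (hv : 0 ≤ v) => mul_nonneg (inv_nonneg.2 hω.le) hv) (convex_Ici 0)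
  refine (hscaled.smul (c := N * unitBallVolume N) (by positivity)).congr fun v _ => ?_
  simp [perimeterOfVolume, div_eq_inv_mul]

theorem add_mul_perimeter_le (hr : 0 ≤ r) (hs : 0 ≤ s) (hρ : 0 ≤ ρ) (hα : 0 ≤ α) (hβ : 0 ≤ β)
    (hαβ : α + β = 1) (h : α * r ^ N + β * s ^ N = ρ ^ N) :
    α * perimeter N r + β * perimeter N s ≤ perimeter N ρ := by
  have hω := unitBallVolume_pos N
  have hconcave := (concaveOn_perimeterOfVolume (N := N)).2
    (x := unitBallVolume N * r ^ N) (y := unitBallVolume N * s ^ N)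
    (Set.mem_Ici.2 (by positivity)) (Set.mem_Ici.2 (by positivity)) hα hβ hαβ
  have hvolume : α • (unitBallVolume N * r ^ N) + β • (unitBallVolume N * s ^ N) =
      unitBallVolume N * ρ ^ N := by
    rw [← h, smul_eq_mul, smul_eq_mul]
    ring
  rwa [hvolume, perimeterOfVolume_mul_pow hr, perimeterOfVolume_mul_pow hs,
    perimeterOfVolume_mul_pow hρ] at hconcave

theorem inner_ballIndicator_ballIndicator_of_pow_eq {t : ℝ} (hr : 0 ≤ r) (hrρ : r ≤ ρ)
    (hρs : ρ ≤ s) (hs : s ≤ R) (hαβ : α + β = 1) (h : α * r ^ N + β * s ^ N = ρ ^ N)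
    (ht : 0 ≤ t) (htR : t ≤ R) (htrs : t ≤ r ∨ s ≤ t) :
    inner ℝ (ballIndicator N R t) (ballIndicator N R ρ) =
      α * inner ℝ (ballIndicator N R t) (ballIndicator N R r) +
        β * inner ℝ (ballIndicator N R t) (ballIndicator N R s) := by
  rcases htrs with htr | hst
  · rw [inner_ballIndicator_ballIndicator ht (htr.trans hrρ) (hρs.trans hs),
      inner_ballIndicator_ballIndicator ht htr ((hrρ.trans hρs).trans hs),
      inner_ballIndicator_ballIndicator ht ((htr.trans hrρ).trans hρs) hs, ← add_mul, hαβ,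
      one_mul]
  · simp only [real_inner_comm _ (ballIndicator N R t)]
    rw [inner_ballIndicator_ballIndicator (hr.trans hrρ) (hρs.trans hst) htR,
      inner_ballIndicator_ballIndicator hr ((hrρ.trans hρs).trans hst) htR,
      inner_ballIndicator_ballIndicator ((hr.trans hrρ).trans hρs) hst htR, ← h]
    ring

theorem uniformChain_radius_le (hR : 0 ≤ R) (n : ℕ) {j k : ℕ} (hjk : j ≤ k) :
    (j : ℝ) * R / n ≤ k * R / n := by
  gcongr

theorem uniformChain_radius_le_self (hR : 0 ≤ R) {n k : ℕ} (hk : k ≤ n) : (k : ℝ) * R / n ≤ R :=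
  div_le_of_le_mul₀ n.cast_nonneg hR (by rw [mul_comm R]; gcongr)

theorem uniformChain_volume_lt (hR : 0 < R) {n : ℕ} (hn : 0 < n) (k : ℕ) :
    unitBallVolume N * (k * R / n) ^ N < unitBallVolume N * ((k + 1 : ℕ) * R / n) ^ N := by
  refine mul_lt_mul_of_pos_left
    (pow_lt_pow_left₀ ?_ (by positivity) (NeZero.ne N)) (unitBallVolume_pos N)
  gcongr
  exact k.lt_succ_self

theorem inner_ballIndicator_stepSum_uniformChain (hR : 0 ≤ R) {n k : ℕ} (hk : k < n)
    (hkρ : k * R / n ≤ ρ) (hρk : ρ ≤ (k + 1 : ℕ) * R / n) (hαβ : α + β = 1)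
    (h : α * (k * R / n) ^ N + β * ((k + 1 : ℕ) * R / n) ^ N = ρ ^ N) (a : ℕ → ℝ) :
    inner ℝ (ballIndicator N R ρ) (stepSum n (uniformChain N R n) a) =
      α * inner ℝ (uniformChain N R n k) (stepSum n (uniformChain N R n) a) +
        β * inner ℝ (uniformChain N R n (k + 1)) (stepSum n (uniformChain N R n) a) := by
  have hchain (j : ℕ) (hj : j ≤ n) : inner ℝ (uniformChain N R n j) (ballIndicator N R ρ) =
      α * inner ℝ (uniformChain N R n j) (uniformChain N R n k) +
        β * inner ℝ (uniformChain N R n j) (uniformChain N R n (k + 1)) :=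
    inner_ballIndicator_ballIndicator_of_pow_eq (by positivity) hkρ hρk
      (uniformChain_radius_le_self hR hk) hαβ h (by positivity)
      (uniformChain_radius_le_self hR hj)
      ((Nat.lt_or_ge k j).symm.imp (uniformChain_radius_le hR n) (uniformChain_radius_le hR n))
  simp only [real_inner_comm (stepSum _ _ _), inner_stepSum, Finset.mul_sum,
    ← Finset.sum_add_distrib]
  refine Finset.sum_congr rfl fun j hj => ?_
  rw [Finset.mem_range] at hj
  rw [hchain j hj.le, hchain (j + 1) hj]
  ring

/-- Between two consecutive radii the integral of the step function is affine in the enclosed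
volume, whereas the perimeter is concave. -/
theorem abs_inner_ballIndicator_stepSum_le (hR : 0 < R) {n : ℕ} (hn : 0 < n) {a : ℕ → ℝ}
    (ha : ∀ k ≤ n, |inner ℝ (uniformChain N R n k) (stepSum n (uniformChain N R n) a)| ≤
      perimeter N (k * R / n)) (hρ : 0 ≤ ρ) (hρR : ρ < R) :
    |inner ℝ (ballIndicator N R ρ) (stepSum n (uniformChain N R n) a)| ≤ perimeter N ρ := by
  have hk := floor_mul_div_lt hn hρ hρR
  obtain ⟨hle, hlt⟩ := mem_Ico_floor_mul_div hR hn hρ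
  set k := ⌊n * ρ / R⌋₊
  obtain ⟨α, β, hα, hβ, hαβ, h⟩ : ρ ^ N ∈
      segment ℝ ((k * R / n) ^ N) (((k + 1 : ℕ) * R / n) ^ N) :=
    Icc_subset_segment ⟨by gcongr, by gcongr⟩
  rw [smul_eq_mul, smul_eq_mul] at h
  rw [inner_ballIndicator_stepSum_uniformChain hR.le hk hle hlt.le hαβ h]
  calc _ ≤ α * perimeter N (k * R / n) + β * perimeter N ((k + 1 : ℕ) * R / n) := by
        refine (abs_add_le _ _).trans (add_le_add ?_ ?_)
        · rw [abs_mul, abs_of_nonneg hα]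
          exact mul_le_mul_of_nonneg_left (ha k hk.le) hα
        · rw [abs_mul, abs_of_nonneg hβ]
          exact mul_le_mul_of_nonneg_left (ha (k + 1) hk) hβ
    _ ≤ perimeter N ρ := add_mul_perimeter_le (by positivity) (by positivity) hρ hα hβ hαβ h

theorem memLp_comp_floor {n : ℕ} (hn : 0 < n) (a : ℕ → ℝ) :
    MemLp (fun t => a ⌊n * t / R⌋₊) 2 (volume.restrict (Set.Ioo 0 R)) := by
  refine .of_bound ((measurable_of_countable a).comp (by fun_prop)).aestronglyMeasurable
    (∑ k ∈ Finset.range n, ‖a k‖) ?_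
  filter_upwards [ae_restrict_mem measurableSet_Ioo] with t ht
  exact Finset.single_le_sum (f := fun k => ‖a k‖) (fun k _ => norm_nonneg _)
    (Finset.mem_range.2 (floor_mul_div_lt hn ht.1.le ht.2))

theorem isConcaveChain_uniformChain (hR : 0 < R) {n : ℕ} (hn : 0 < n) :
    IsConcaveChain (dualBall (Metric.ball (0 : Euc N) R)) n (uniformChain N R n)
      (fun k => unitBallVolume N * (k * R / n) ^ N) (fun k => perimeter N (k * R / n)) where
  lt k _ := uniformChain_volume_lt hR hn k
  zero := by simp [uniformChain, ballIndicator_zero]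
  inner_eq j k hjk hk := inner_ballIndicator_ballIndicator (by positivity)
    (uniformChain_radius_le hR.le n hjk) (uniformChain_radius_le_self hR.le hk)
  concave k _ := by
    have hslope := (concaveOn_perimeterOfVolume (N := N)).slope_anti_adjacent
      (mul_nonneg (unitBallVolume_pos N).le (by positivity))
      (mul_nonneg (unitBallVolume_pos N).le (by positivity))
      (uniformChain_volume_lt hR hn k) (uniformChain_volume_lt hR hn (k + 1))
    have hperimeter (j : ℕ) := perimeterOfVolume_mul_pow (N := N) (r := j * R / n) (by positivity)
    simpa only [hperimeter] using hslope
  abs_le p hp k hk := by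
    rcases k.eq_zero_or_pos with rfl | hk0
    · have hω := unitBallVolume_pos N
      have hperimeter : 0 ≤ perimeter N 0 := by unfold perimeter; positivity
      simpa [uniformChain, ballIndicator_zero] using hperimeter
    · exact abs_inner_ballIndicator_le (by positivity) (uniformChain_radius_le_self hR.le hk) p hp
  last p hp := by
    rw [uniformChain, mul_div_cancel_left₀ _ (Nat.cast_ne_zero.2 hn.ne')]
    exact inner_ballIndicator_self_eq_zero p hp
  mem a ha hlast := by
    rw [uniformChain, mul_div_cancel_left₀ _ (Nat.cast_ne_zero.2 hn.ne')] at hlast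
    exact mem_dualBall_of_abs_inner_ballIndicator_le hR (memLp_comp_floor hn a)
      (coeFn_stepSum_uniformChain hR hn a)
      (fun r hr => abs_inner_ballIndicator_stepSum_le hR hn ha hr.1.le hr.2) hlast

end UniformChain

theorem T_add_of_mem_radialSteps [NeZero N] {R : ℝ} (hR : 0 < R)
    {g : L2 (Metric.ball (0 : Euc N) R)} (hg : g ∈ radialSteps N R) {lam ν : ℝ} (hlam : 0 < lam)
    (hν : 0 < ν) :
    T (Metric.ball 0 R) (lam + ν) g = T (Metric.ball 0 R) ν (T (Metric.ball 0 R) lam g) := by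
  obtain ⟨n, hn, b, rfl⟩ := hg
  obtain ⟨p, hp, hgp⟩ := (eq_T_iff_exists_isSupport hlam).1 (Eq.refl (T (Metric.ball 0 R) lam _))
  obtain ⟨q, hq, huq⟩ := (eq_T_iff_exists_isSupport hν).1
    (Eq.refl (T (Metric.ball 0 R) ν (T (Metric.ball 0 R) lam _)))
  exact ((eq_T_iff_exists_isSupport (add_pos hlam hν)).2
    ((isConcaveChain_uniformChain hR hn).exists_isSupport_add_smul_add
      (convex_dualBall _) hlam hν hp hgp hq huq)).symm

theorem IsRadial.T_add [NeZero N] {R : ℝ} (hR : 0 < R) {g : L2 (Metric.ball (0 : Euc N) R)}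
    (hg : IsRadial (Metric.ball 0 R) g) {lam ν : ℝ} (hlam : 0 < lam) (hν : 0 < ν) :
    T (Metric.ball 0 R) (lam + ν) g = T (Metric.ball 0 R) ν (T (Metric.ball 0 R) lam g) :=
  closure_minimal (fun _ hv => T_add_of_mem_radialSteps hR hv hlam hν)
    (isClosed_eq (continuous_T (add_pos hlam hν)) ((continuous_T hν).comp (continuous_T hlam)))
    (hg.mem_closure_radialSteps hR)

end ROF

theorem mainTheorem4_general (N : ℕ) [NeZero N] (R : ℝ) (hR : 0 < R) :
    (∀ (ν : ℝ), 0 < ν → ∀ h : ROF.L2 (Metric.ball (0 : ROF.Euc N) R),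
      ROF.IsMinimizer (Metric.ball 0 R) ν h (ROF.T (Metric.ball 0 R) ν h) ∧
      ∀ u, ROF.IsMinimizer (Metric.ball 0 R) ν h u → u = ROF.T (Metric.ball 0 R) ν h) ∧
    (∀ (ν : ℝ), 0 < ν → ∀ h u : ROF.L2 (Metric.ball (0 : ROF.Euc N) R),
      u = ROF.T (Metric.ball 0 R) ν h ↔
        ∃ p ∈ ROF.subdiffTV (Metric.ball 0 R) u, h = u + ν • p) ∧
    (∀ g : ROF.L2 (Metric.ball (0 : ROF.Euc N) R), ROF.IsRadial (Metric.ball 0 R) g →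
      ∀ lam mu : ℝ, 0 ≤ lam → lam < mu →
        ROF.T (Metric.ball 0 R) mu g =
          ROF.T (Metric.ball 0 R) (mu - lam) (ROF.T (Metric.ball 0 R) lam g)) := by
  refine ⟨fun ν hν h => ⟨ROF.isMinimizer_T hν h, fun u => (ROF.isMinimizer_iff_eq_T hν).1⟩,
    fun ν hν h u => ROF.eq_T_iff_exists_mem_subdiffTV hν, fun g hg lam mu hlam hmu => ?_⟩
  rcases hlam.eq_or_lt with rfl | hlam
  · have hT_zero : ROF.T (Metric.ball 0 R) 0 g = g := if_pos rfl
    rw [hT_zero, sub_zero]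
  · simpa using hg.T_add hR hlam (sub_pos.2 hmu)

theorem mainTheorem4 (N : ℕ) (hN : 2 ≤ N) (R : ℝ) (hR : 0 < R) :
    -- the operators are well defined: for positive parameter, the minimizer exists and is unique
    (∀ (ν : ℝ), 0 < ν → ∀ h : ROF.L2 (Metric.ball (0 : ROF.Euc N) R),
      ROF.IsMinimizer (Metric.ball 0 R) ν h (ROF.T (Metric.ball 0 R) ν h) ∧
      ∀ u, ROF.IsMinimizer (Metric.ball 0 R) ν h u → u = ROF.T (Metric.ball 0 R) ν h) ∧
    -- they are the resolvents `(I + ν ∂TV)⁻¹`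
    (∀ (ν : ℝ), 0 < ν → ∀ h u : ROF.L2 (Metric.ball (0 : ROF.Euc N) R),
      u = ROF.T (Metric.ball 0 R) ν h ↔
        ∃ p ∈ ROF.subdiffTV (Metric.ball 0 R) u, h = u + ν • p) ∧
    -- the semigroup property for radial data
    (∀ g : ROF.L2 (Metric.ball (0 : ROF.Euc N) R), ROF.IsRadial (Metric.ball 0 R) g →
      ∀ lam mu : ℝ, 0 ≤ lam → lam < mu →
        ROF.T (Metric.ball 0 R) mu g =
          ROF.T (Metric.ball 0 R) (mu - lam) (ROF.T (Metric.ball 0 R) lam g)) := by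
  have : NeZero N := ⟨by omega⟩
  exact mainTheorem4_general N R hR
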